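/- **Model.** A cubical 3-dimensional mesh of edge length $s$ has the $s^3$ processors $\{0,\dots,s-1\}^3$, each linked to its at most six axis neighbours. Each processor has a fixed number $R$ of registers, each empty or holding one element of a set $V$ with two binary operations $\oplus,\otimes$, and a control state of a fixed number $w$ of words with $s^3+2$ possible values each. In one synchronous unit of time a processor sends at most one element over each link, stores elements it received, rearranges its registers, performs at most one operation $\oplus$ or $\otimes$ on registers, and updates its control state from its own, those of its neighbours, and the outcome of emptiness and equality tests on its registers. All processors of a program have the same transition rule, which may depend on $s$ and on the problem size, and an individual initial control state; elements of $V$ are only ever copied, moved, tested for equality, and combined by $\oplus$ and $\otimes$. A layout of $n\times n$ matrices places the entries at distinct processors. Given layouts of $A$, $B$ and $C$, a program computes the general product of $n\times n$ matrices within time $T$ if, for every $V$, every $\otimes$, every associative $\oplus$ and all $A,B\in V^{n\times n}$ (every entry stored once, by the layouts of $A$ and $B$), it halts after at most $T$ steps with $$C(i,j)=\bigoplus_{k=0}^{n-1}A(i,k)\otimes B(k,j)\qquad(0\le i,j<n,\ \text{summands in this order})$$ stored by the layout of $C$. Its (worst-case) running time is the least such $T$. **Algorithm A** for $n\times n$ matrices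 on the mesh of edge length $\lceil n^{\alpha/3}\rceil$ (size $n^\alpha$ up to rounding), $2\le\alpha\le 9/4$: halve the three index ranges and the three edges of the mesh $d=\lfloor(\alpha-2)\log_2 n\rfloor$ times, at each level assigning the product of blocks $A_{I,K}$, $B_{K,J}$ to the subcube $O_{I,K,J}$; compute the products of the last-level blocks (of side about $n^{3-\alpha}$) in their subcubes (of size about $n^{6-2\alpha}$); then, going back through the levels, add by $\oplus$ the results of the two halves of the summation range within the subcube of the respective subproblem. An implementation of Algorithm A is a program whose course does not depend on the entries and whose operations $\oplus,\otimes$ are exactly of these kinds, carried out in these subcubes. **Theorem.** (i) There are fixed $R$ and $w$ such that for every real $\alpha$ with $2\le\alpha\le 9/4$ there are constants $c_\alpha,C_\alpha>0$ for which the following holds for all $n\ge1$. Let $A$, $B$ be $n\times n$ matrices stored in any layouts in the corner subcube of edge length $\lceil n^{2/3}\rceil$ of the mesh of edge length $\lceil n^{\alpha/3}\rceil$, and let any layout in this corner be prescribed for the result. Then an implementation of Algorithm A with $R$ registers and $w$ control words per processor computes the general matrix product, with running time $T$ satisfying $c_\alpha n^{3-\alpha}\le T\le C_\alpha n^{3-\alpha}$.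 In particular the running time is $\Theta(n^{3/4})$ for $\alpha=9/4$. (ii) This is optimal: there is a constant $c>0$ such that for all $n$, all cubical 3-dimensional meshes of any size, all layouts of $A$, $B$ and $C$ in the mesh, and all $R$, $w$, every program that computes the general product of $n\times n$ matrices within time $T$ satisfies $T\ge c\,n^{3/4}$. -/

import Mathlib

universe u

namespace Mesh

/-! ### General matrix multiplication -/

/-- `x₀ ⊕ x₁ ⊕ ⋯`, in this order. No identity is assumed, so the empty sum is `none`. -/
def orderedSum {V : Type*} (add : V → V → V) : List V → Option V
  | [] => none
  | x :: xs => some (xs.foldl add x)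

/-- The entry `C(i,j) = ⨁_{k=0}^{n-1} A(i,k) ⊗ B(k,j)` of the general matrix product. -/
def generalProduct {V : Type*} {n : ℕ} (add mul : V → V → V)
    (A B : Matrix (Fin n) (Fin n) V) (i j : Fin n) : Option V :=
  orderedSum add ((List.finRange n).map fun k => mul (A i k) (B k j))

/-! ### The cubical mesh -/

/-- The processors of the cubical 3-dimensional mesh of edge length `s` (hence of size `s ^ 3`). -/
abbrev Proc (s : ℕ) := Fin 3 → Fin s

/-- The six directions: an axis, and whether the coordinate increases. -/
abbrev Dir := Fin 3 × Bool

/-- The opposite direction. -/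
def Dir.opp (d : Dir) : Dir := (d.1, !d.2)

/-- The neighbour of `p` in direction `d`, if there is one (the mesh does not wrap around). -/
def nbr {s : ℕ} (p : Proc s) (d : Dir) : Option (Proc s) :=
  if d.2 then
    if h : (p d.1 : ℕ) + 1 < s then some (Function.update p d.1 ⟨(p d.1 : ℕ) + 1, h⟩) else none
  else
    if (p d.1 : ℕ) = 0 then none
    else some (Function.update p d.1
      ⟨(p d.1 : ℕ) - 1, lt_of_le_of_lt (Nat.sub_le _ _) (p d.1).isLt⟩)

/-! ### Mesh programs

Every processor has `R` registers, each of which is empty or holds one matrix-type word (an element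
of the carrier `V`), and a control state, consisting of `w` words of `O(log p)` bits on a mesh
with `p` processors. The elements of `V` can be copied, moved, tested for equality and
combined by `⊕` and `⊗`. -/

/-- What is put into a register in the communication half of a time step: the content of one of the
processor's own registers, the word received from the neighbour in some direction, or nothing. -/
inductive Source (R : ℕ)
  | own (r : Fin R)
  | inbox (d : Dir)
  | clear

inductive OpKind
  | plus
  | times

/-- The instruction `dest := left ⊕ right` or `dest := left ⊗ right` on registers. -/
structure Instr (R : ℕ) where
  kind : OpKind
  left : Fin R
  right : Fin R
  dest : Fin R

/-- What a processor does in one time step: it sends at most one word over each of its links, loads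
its registers, and then performs at most one operation `⊕` or `⊗`. -/
structure Action (R : ℕ) where
  send : Dir → Option (Fin R)
  load : Fin R → Source R
  op : Option (Instr R)

/-- A program for the mesh of edge length `s`, with `R` registers and `w` control words per
processor. All processors have the same transition rule; they differ by their
initial control state, which may contain their coordinates. -/
structure Program (s R w : ℕ) where
  /-- The control states. -/
  Ctrl : Type
  finite_ctrl : Finite Ctrl
  /-- A control state fits into `w` words with `s ^ 3 + 2` possible values each. -/
  card_ctrl : Nat.card Ctrl ≤ (s ^ 3 + 2) ^ w
  init : Proc s → Ctrl
  act : Ctrl → Action R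
  /-- The new control state, computed from the old one, those of the neighbours, and the outcome of
  testing which registers are full and which pairs of registers have the same content. -/
  next : Ctrl → (Dir → Option Ctrl) → (Fin R → Bool) → (Fin R → Fin R → Bool) → Ctrl
  halted : Ctrl → Bool
  /-- The registers where the entries of `A`, `B` are found and those of `C` are to be put. -/
  regA : Fin R
  regB : Fin R
  regC : Fin R
  regA_ne_regB : regA ≠ regB

/-- The state of the whole mesh. -/
structure Config (s R : ℕ) (Q V : Type*) where
  ctrl : Proc s → Q
  reg : Proc s → Fin R → Option V

/-- An assignment of the entries of an `n × n` matrix to processors, at most one per processor. -/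
abbrev Layout (n s : ℕ) := (Fin n × Fin n) ↪ Proc s

/-- The entry of `M` stored at the processor `p` by the layout `L`, if any. -/
noncomputable def stored {V : Type*} {n s : ℕ} (L : Layout n s) (M : Matrix (Fin n) (Fin n) V)
    (p : Proc s) : Option V :=
  (Function.partialInv L p).map fun e => M e.1 e.2

namespace Program

variable {s R w : ℕ} (P : Program s R w) {V : Type*} (add mul : V → V → V)

/-- The word that `p` receives from its neighbour in direction `d`. -/
def received (c : Config s R P.Ctrl V) (p : Proc s) (d : Dir) : Option V :=
  (nbr p d).bind fun q => ((P.act (c.ctrl q)).send d.opp).bind fun r => c.reg q r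

/-- The registers of `p` after the communication half of a time step. -/
def loaded (c : Config s R P.Ctrl V) (p : Proc s) (r : Fin R) : Option V :=
  match (P.act (c.ctrl p)).load r with
  | .own r' => c.reg p r'
  | .inbox d => P.received c p d
  | .clear => none

/-- The registers of `p` after a whole time step. An operation with an empty operand has an
empty result. -/
def computed (c : Config s R P.Ctrl V) (p : Proc s) : Fin R → Option V :=
  match (P.act (c.ctrl p)).op with
  | none => P.loaded c p
  | some I =>
    let f := match I.kind with
      | .plus => add
      | .times => mul
    Function.update (P.loaded c p) I.dest (Option.map₂ f (P.loaded c p I.left) (P.loaded c p I.right))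

open Classical in
/-- One synchronous time step of the mesh. -/
noncomputable def step (c : Config s R P.Ctrl V) : Config s R P.Ctrl V where
  ctrl p := P.next (c.ctrl p) (fun d => (nbr p d).map c.ctrl)
    (fun r => (c.reg p r).isSome) (fun r r' => decide (c.reg p r = c.reg p r'))
  reg p := P.computed add mul c p

/-- The initial state: the entries of `A` and `B` are placed according to the layouts, and all other
registers are empty. -/
noncomputable def start {n : ℕ} (LA LB : Layout n s) (A B : Matrix (Fin n) (Fin n) V) :
    Config s R P.Ctrl V where
  ctrl := P.init
  reg p r := if r = P.regA then stored LA A p else if r = P.regB then stored LB B p else none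

/-- The state after `t` time steps. -/
noncomputable def run {n : ℕ} (LA LB : Layout n s) (A B : Matrix (Fin n) (Fin n) V) (t : ℕ) :
    Config s R P.Ctrl V :=
  (P.step add mul)^[t] (P.start LA LB A B)

/-- All processors have halted. -/
def AllHalted (c : Config s R P.Ctrl V) : Prop := ∀ p, P.halted (c.ctrl p) = true

/-- The computation ends after exactly `t` time steps. -/
def HaltsAt {n : ℕ} (LA LB : Layout n s) (A B : Matrix (Fin n) (Fin n) V) (t : ℕ) : Prop :=
  P.AllHalted (P.run add mul LA LB A B t) ∧ ∀ t' < t, ¬ P.AllHalted (P.run add mul LA LB A B t')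

/-- `P` is a correct program for general matrix multiplication of `n × n` matrices, with inputs
placed by `LA`, `LB` and output placed by `LC`, and its worst-case running time is at most `T`. -/
def ComputesWithin {s R w : ℕ} (P : Program s R w) {n : ℕ} (LA LB LC : Layout n s)
    (T : ℕ) : Prop :=
  ∀ (V : Type u) (add mul : V → V → V),
    (∀ x y z, add (add x y) z = add x (add y z)) →
    ∀ A B : Matrix (Fin n) (Fin n) V, ∃ t ≤ T, P.HaltsAt add mul LA LB A B t ∧
      ∀ i j, (P.run add mul LA LB A B t).reg (LC (i, j)) P.regC = generalProduct add mul A B i j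

/-- In the state `c` the processor `p` is about to apply the operation `kind` to `u` and `v`. -/
def Executes (c : Config s R P.Ctrl V) (p : Proc s) (kind : OpKind) (u v : V) : Prop :=
  ∃ I, (P.act (c.ctrl p)).op = some I ∧ I.kind = kind ∧
    P.loaded c p I.left = some u ∧ P.loaded c p I.right = some v

end Program

/-! ### Algorithm A

The algorithm halves the index ranges of the matrices and the edges of the mesh `depth` times.
After `r` halvings the product of the blocks `A_{I,K}` and `B_{K,J}` is the task of the subcube
`O_{I,K,J}`. The products of blocks at the last level are computed within the subcubes, and the results
are then added recursively. We express this by the operations that the program carries out when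
it is run on matrices of formal symbols. -/

/-- Formal expressions in the entries of two `n × n` matrices. -/
inductive Term (n : ℕ)
  | entryA (i k : Fin n)
  | entryB (k j : Fin n)
  | plus (u v : Term n)
  | times (u v : Term n)

/-- The index of the part that contains `x` after the range `0, …, N - 1` has been halved `r` times
(halves differ in length by rounding only). -/
def part (N r x : ℕ) : ℕ := 2 ^ r * x / N

/-- After `r` halvings, the product `A(i,k) ⊗ B(k,j)` belongs to the subcube that contains `p`. -/
def InSubcube {n s : ℕ} (r : ℕ) (p : Proc s) (i k j : Fin n) : Prop :=
  part n r i = part s r (p 0) ∧ part n r k = part s r (p 1) ∧ part n r j = part s r (p 2)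

/-- `PartialSum i j lo hi u`: the expression `u` is `⨁_{lo ≤ k < hi} A(i,k) ⊗ B(k,j)`, with the
summands in this order and brackets of any form. -/
inductive PartialSum {n : ℕ} (i j : Fin n) : ℕ → ℕ → Term n → Prop
  | single (k : Fin n) : PartialSum i j k (k + 1) (.times (.entryA i k) (.entryB k j))
  | plus {lo mid hi : ℕ} {u v : Term n} (hu : PartialSum i j lo mid u)
      (hv : PartialSum i j mid hi v) : PartialSum i j lo hi (.plus u v)

/-- The scalar product `u ⊗ v` at `p` is `A(i,k) ⊗ B(k,j)`, and after `d` halvings it belongs to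
the subcube of `p`. -/
def AllowedTimes {n s : ℕ} (d : ℕ) (p : Proc s) (u v : Term n) : Prop :=
  ∃ i k j : Fin n, u = .entryA i k ∧ v = .entryB k j ∧ InSubcube d p i k j

/-- The addition `u ⊕ v` at `p` joins two consecutive partial sums of one entry `C(i,j)`: either it
belongs to the multiplication of two blocks at the last level and takes place in their subcube, or
it adds the results of the two halves of the summation range of a subproblem at an earlier level `r`
and takes place in the subcube of this subproblem. -/
def AllowedPlus {n s : ℕ} (d : ℕ) (p : Proc s) (u v : Term n) : Prop :=
  ∃ (i j : Fin n) (lo mid hi : ℕ), PartialSum i j lo mid u ∧ PartialSum i j mid hi v ∧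
    ((∀ k : Fin n, lo ≤ k ∧ k < hi → InSubcube d p i k j) ∨
      ∃ r < d, (∀ k : Fin n, (lo ≤ k ∧ k < hi) ↔ InSubcube r p i k j) ∧
        ∀ k : Fin n, (lo ≤ k ∧ k < mid) ↔ (InSubcube r p i k j ∧ part n (r + 1) k % 2 = 0))

/-- `P` is an implementation of Algorithm A with `d` levels of recursion: the course of the
computation is fixed in advance (it does not depend on the entries), and all operations are those of the
recursive scheme, carried out in the right subcubes. -/
def Program.FollowsAlgorithmA {s R w : ℕ} (P : Program s R w) {n : ℕ} (LA LB : Layout n s)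
    (d : ℕ) : Prop :=
  (∀ q N full full' same same', P.next q N full same = P.next q N full' same') ∧
  let c := P.run Term.plus Term.times LA LB (Matrix.of Term.entryA) (Matrix.of Term.entryB)
  ∀ t, (∀ t' ≤ t, ¬ P.AllHalted (c t')) → ∀ (p : Proc s) (u v : Term n),
    (P.Executes (c t) p .times u v → AllowedTimes d p u v) ∧
    (P.Executes (c t) p .plus u v → AllowedPlus d p u v)

/-! ### Sizes -/

/-- The edge length of the mesh of size `n ^ α`, rounded up. -/
noncomputable def edge (α : ℝ) (n : ℕ) : ℕ := ⌈(n : ℝ) ^ (α / 3)⌉₊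

/-- The number `(α - 2) lg n` of levels of recursion, rounded down; it leads to about
`n ^ (3 α - 6)` subcubes of size about `n ^ (6 - 2 α)`. -/
noncomputable def depth (α : ℝ) (n : ℕ) : ℕ := ⌊(α - 2) * Real.logb 2 n⌋₊

/-- The matrix is stored in the corner of the mesh, in the smallest cube that can hold it. -/
def Layout.InCorner {n s : ℕ} (L : Layout n s) : Prop :=
  ∀ e a, (L e a : ℕ) < edge 2 n

/-- On a mesh of size `n ^ α`, for two `n × n` matrices given in the corner in any arrangement,
Algorithm A computes the general matrix product, delivers it in any arrangement wanted in the corner,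
and its worst-case running time is `Θ(n ^ β)`; it needs `R` registers and `w` control words
per processor. -/
def AlgorithmATakesTheta (R w : ℕ) (α β : ℝ) : Prop :=
  ∃ c C : ℝ, 0 < c ∧ 0 < C ∧ ∀ n : ℕ, 1 ≤ n → ∀ LA LB LC : Layout n (edge α n),
    LA.InCorner → LB.InCorner → LC.InCorner →
    ∃ (P : Program (edge α n) R w) (T : ℕ), P.FollowsAlgorithmA LA LB (depth α n) ∧
      IsLeast {T' : ℕ | Program.ComputesWithin.{u} P LA LB LC T'} T ∧
      c * (n : ℝ) ^ β ≤ T ∧ (T : ℝ) ≤ C * (n : ℝ) ^ β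

end Mesh

/-!
In Algorithm A the operations do not depend on the entries, so an implementation is a schedule, and
it is enough to follow the schedule on matrices of formal symbols. At the last level, the `2 ^ d`
blocks per index range are cut into a bounded number of chunks of side `L * l`, where `L` is the
edge of a subcube and `l` is about `√L`: a square matrix of this side fits into a subcube. Rows and
columns are numbered with one digit below `L` and one digit below `l`, the two digits below `l`
together being the number of a layer of the subcube, so that every layer of the subcube holds an
`L × L` matrix of each operand. In each of `l` rounds, `L` consecutive summands of all entries of
`C` are formed and added: the layers fetch the operands that they need along the third axis, and
multiply the matrices systolically in time `O(L)`. The whole takes `O(L * l) = O(n ^ (3 - α))`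
steps. Distributing the chunks, adding them up along the axis of summation, and collecting the
result take time `O(s)` on the mesh of edge length `s`: by König's edge colouring theorem, every
permutation of the processors is a product of five permutations along the axes.

For the lower bounds, a program is run on elements that record which scalar products they contain.
Within time `T` all `n ^ 3` scalar products are formed, each in a step of a processor of its own,
and information travels at most `T` steps along each axis. As `C(i,j)` depends on row `i` of `A`
and on column `j` of `B`, all processors that form a scalar product lie in a common cube of edge
length `10 * T + 1`, whence `n ^ 3 ≤ (10 * T + 1) ^ 3 * T`.
-/

namespace Mesh

open Finset Function

/-! ### Permutations of grids -/

section EdgeColouring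

variable {ι X Y Z : Type*} {E : Finset ι} {μ : X → ι} {h : ι → Z} {k : ℕ}

lemma exists_matching_of_regular [Finite X] [Finite Y] [DecidableEq X] [DecidableEq Y]
    (hk : 0 < k) {f : ι → X} {g : ι → Y} (hf : ∀ x, #{e ∈ E | f e = x} = k)
    (hg : ∀ y, #{e ∈ E | g e = y} = k) :
    ∃ μ : X → ι, (∀ x, μ x ∈ E) ∧ Bijective (f ∘ μ) ∧ Bijective (g ∘ μ) := by
  have := Fintype.ofFinite X
  have := Fintype.ofFinite Y
  have card_f (S : Finset X) : #{e ∈ E | f e ∈ S} = #S * k := by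
    simp [← sum_card_fiberwise_eq_card_filter, hf]
  have card_g (S : Finset Y) : #{e ∈ E | g e ∈ S} = #S * k := by
    simp [← sum_card_fiberwise_eq_card_filter, hg]
  let N (x : X) : Finset Y := {e ∈ E | f e = x}.image g
  have hall (S : Finset X) : #S ≤ #(S.biUnion N) := by
    refine Nat.le_of_mul_le_mul_right ?_ hk
    rw [← card_f, ← card_g]
    refine card_le_card fun e he => ?_
    obtain ⟨heE, heS⟩ := mem_filter.1 he
    exact mem_filter.2 ⟨heE, mem_biUnion.2
      ⟨f e, heS, mem_image_of_mem g (mem_filter.2 ⟨heE, rfl⟩)⟩⟩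
  obtain ⟨m, hm, hmN⟩ := (all_card_le_biUnion_card_iff_exists_injective N).1 hall
  have hcard : Fintype.card X = Fintype.card Y := by
    have hX := card_f univ
    have hY := card_g univ
    simp only [mem_univ, filter_true, card_univ] at hX hY
    exact Nat.eq_of_mul_eq_mul_right hk (hX.symm.trans hY)
  choose μ hμ hμg using fun x => mem_image.1 (hmN x)
  simp only [mem_filter] at hμ
  refine ⟨μ, fun x => (hμ x).1, ?_, ?_⟩
  · rw [show f ∘ μ = id from funext fun x => (hμ x).2]
    exact bijective_id
  · rw [show g ∘ μ = m from funext hμg]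
    exact (Fintype.bijective_iff_injective_and_card m).2 ⟨hm, hcard⟩

lemma card_filter_sdiff_matching [DecidableEq ι] [Fintype X] [DecidableEq Z]
    (hμ : ∀ x, μ x ∈ E) (hbij : Bijective (h ∘ μ)) (hE : ∀ z, #{e ∈ E | h e = z} = k + 1) (z : Z) :
    #{e ∈ E \ univ.image μ | h e = z} = k := by
  obtain ⟨x, hx⟩ := hbij.surjective z
  have herase : {e ∈ E \ univ.image μ | h e = z} = {e ∈ E | h e = z}.erase (μ x) := by
    ext e
    simp only [mem_filter, mem_sdiff, mem_image, mem_univ, true_and, not_exists, mem_erase]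
    constructor
    · rintro ⟨⟨heE, he⟩, hez⟩
      exact ⟨Ne.symm (he x), heE, hez⟩
    · rintro ⟨hex, heE, hez⟩
      refine ⟨⟨heE, fun y hy => hex ?_⟩, hez⟩
      rw [← hy, hbij.injective (by simp [hy, hez, ← hx] : (h ∘ μ) y = (h ∘ μ) x)]
  rw [herase, card_erase_of_mem (mem_filter.2 ⟨hμ x, hx⟩), hE, Nat.add_sub_cancel]

lemma injOn_colouring_extend [DecidableEq ι] [Fintype X] {c : ι → ℕ} (hinj : Injective (h ∘ μ))
    (hlt : ∀ e ∈ E \ univ.image μ, c e < k)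
    (hc : Set.InjOn (fun e => (h e, c e)) ↑(E \ univ.image μ)) :
    Set.InjOn (fun e => (h e, if e ∈ univ.image μ then k else c e)) E := by
  intro e he e' he' hee'
  obtain ⟨hh, hcol⟩ := Prod.mk.inj hee'
  by_cases hmem : e ∈ univ.image μ <;> by_cases hmem' : e' ∈ univ.image μ <;>
    simp only [hmem, hmem', if_true, if_false] at hcol
  · obtain ⟨x, -, rfl⟩ := mem_image.1 hmem
    obtain ⟨x', -, rfl⟩ := mem_image.1 hmem'
    rw [hinj hh]
  · exact absurd hcol.symm (hlt e' (mem_sdiff.2 ⟨he', hmem'⟩)).ne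
  · exact absurd hcol (hlt e (mem_sdiff.2 ⟨he, hmem⟩)).ne
  · exact hc (mem_sdiff.2 ⟨he, hmem⟩) (mem_sdiff.2 ⟨he', hmem'⟩) (Prod.ext hh hcol)

/-- König: the elements of `E` are the edges, from `f e` to `g e`, of a bipartite multigraph. -/
lemma exists_edgeColouring_of_regular [Finite X] [Finite Y] [DecidableEq X] [DecidableEq Y]
    {f : ι → X} {g : ι → Y} (hf : ∀ x, #{e ∈ E | f e = x} = k)
    (hg : ∀ y, #{e ∈ E | g e = y} = k) :
    ∃ c : ι → ℕ, (∀ e ∈ E, c e < k) ∧ Set.InjOn (fun e => (f e, c e)) E ∧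
      Set.InjOn (fun e => (g e, c e)) E := by
  classical
  have := Fintype.ofFinite X
  induction k generalizing E with
  | zero =>
    obtain rfl : E = ∅ := eq_empty_of_forall_notMem fun e he =>
      filter_eq_empty_iff.1 (card_eq_zero.1 (hf (f e))) he rfl
    simp
  | succ k ih =>
    obtain ⟨μ, hμ, hfμ, hgμ⟩ := exists_matching_of_regular k.succ_pos hf hg
    obtain ⟨c, hlt, hcf, hcg⟩ :=
      ih (card_filter_sdiff_matching hμ hfμ hf) (card_filter_sdiff_matching hμ hgμ hg)
    refine ⟨fun e => if e ∈ univ.image μ then k else c e, fun e he => ?_,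
      injOn_colouring_extend hfμ.injective hlt hcf, injOn_colouring_extend hgμ.injective hlt hcg⟩
    dsimp only
    split_ifs with hmem
    · exact k.lt_succ_self
    · exact (hlt e (mem_sdiff.2 ⟨he, hmem⟩)).trans k.lt_succ_self

end EdgeColouring

-- Colouring each cell by the row in which it crosses between columns is an edge colouring of the
-- multigraph of columns that has an edge from the column of `p` to the column of `π p`.
lemma exists_column_row_column {X Y : Type*} [Finite X] [Finite Y] (π : Equiv.Perm (X × Y)) :
    ∃ f₁ f₂ f₃ : Equiv.Perm (X × Y), (∀ p, (f₁ p).1 = p.1) ∧ (∀ p, (f₂ p).2 = p.2) ∧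
      (∀ p, (f₃ p).1 = p.1) ∧ ∀ p, π p = f₁ (f₂ (f₃ p)) := by
  classical
  have := Fintype.ofFinite X
  have := Fintype.ofFinite Y
  have hfst (x : X) : #{p : X × Y | p.1 = x} = Fintype.card Y := by
    rw [show ({p : X × Y | p.1 = x} : Finset _) = {x} ×ˢ univ by
      ext ⟨a, b⟩; simp [eq_comm]]
    simp
  have hπ (x : X) : #{p | (π p).1 = x} = Fintype.card Y := by
    rw [← hfst x, ← card_map π.toEmbedding]
    congr 1
    ext p
    simp
  obtain ⟨c, hlt, hcf, hcg⟩ := exists_edgeColouring_of_regular hfst hπ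
  let row (p : X × Y) : Y := (Fintype.equivFin Y).symm ⟨c p, hlt p (mem_univ p)⟩
  have hrow {p q : X × Y} (h : row p = row q) : c p = c q := by simpa [row] using h
  let e₁ : Equiv.Perm (X × Y) := .ofBijective (fun p => (p.1, row p))
    (Finite.injective_iff_bijective.1 fun p q h =>
      hcf (mem_univ p) (mem_univ q) (Prod.ext (Prod.mk.inj h).1 (hrow (Prod.mk.inj h).2)))
  let e₂ : Equiv.Perm (X × Y) := .ofBijective (fun p => ((π p).1, row p))
    (Finite.injective_iff_bijective.1 fun p q h =>
      hcg (mem_univ p) (mem_univ q) (Prod.ext (Prod.mk.inj h).1 (hrow (Prod.mk.inj h).2)))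
  refine ⟨e₂.symm.trans π, e₁.symm.trans e₂, e₁, fun p => ?_, fun p => ?_, fun p => rfl,
    fun p => by simp⟩
  · obtain ⟨q, rfl⟩ := e₂.surjective p
    simp [e₂]
  · obtain ⟨q, rfl⟩ := e₁.surjective p
    simp [e₁, e₂]

/-- `f` moves every processor along the axis `a` only. -/
def AlongAxis {s : ℕ} (a : Fin 3) (f : Proc s → Proc s) : Prop :=
  ∀ p b, b ≠ a → f p b = p b

/-- The mesh as a grid whose columns are its lines in the direction of the axis `2`, so that
`exists_column_row_column` applies to it. -/
def procEquiv (s : ℕ) : Proc s ≃ (Fin s × Fin s) × Fin s where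
  toFun p := ((p 0, p 1), p 2)
  invFun q := ![q.1.1, q.1.2, q.2]
  left_inv p := by funext a; fin_cases a <;> rfl
  right_inv q := rfl

lemma alongAxis_two {s : ℕ} {f : (Fin s × Fin s) × Fin s → (Fin s × Fin s) × Fin s}
    (hf : ∀ q, (f q).1 = q.1) : AlongAxis 2 fun p => (procEquiv s).symm (f (procEquiv s p)) := by
  intro p b hb
  fin_cases b
  · exact congrArg Prod.fst (hf (procEquiv s p))
  · exact congrArg Prod.snd (hf (procEquiv s p))
  · exact absurd rfl hb

/-- The map that acts as `k z` on the plane of the processors with coordinate `z` on the axis `2`;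
the middle phase of the routing consists of such maps. -/
def planewise {s : ℕ} (k : Fin s → Fin s × Fin s → Fin s × Fin s) (p : Proc s) : Proc s :=
  (procEquiv s).symm (k (p 2) (p 0, p 1), p 2)

lemma alongAxis_one_planewise {s : ℕ} {k : Fin s → Fin s × Fin s → Fin s × Fin s}
    (hk : ∀ z q, (k z q).1 = q.1) : AlongAxis 1 (planewise k) := by
  intro p b hb
  fin_cases b
  · exact hk (p 2) (p 0, p 1)
  · exact absurd rfl hb
  · rfl

lemma alongAxis_zero_planewise {s : ℕ} {k : Fin s → Fin s × Fin s → Fin s × Fin s}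
    (hk : ∀ z q, (k z q).2 = q.2) : AlongAxis 0 (planewise k) := by
  intro p b hb
  fin_cases b
  · exact absurd rfl hb
  · exact hk (p 2) (p 0, p 1)
  · rfl

lemma exists_perm_plane {α β : Type*} [Finite α] {g : Equiv.Perm (α × β)}
    (hg : ∀ p, (g p).2 = p.2) (z : β) : ∃ ρ : Equiv.Perm α, ∀ q, ρ q = (g (q, z)).1 := by
  refine ⟨.ofBijective (fun q => (g (q, z)).1) (Finite.injective_iff_bijective.1 fun q q' h => ?_),
    fun q => rfl⟩
  exact (Prod.mk.inj (g.injective (Prod.ext h (by rw [hg, hg])))).1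

lemma exists_five_alongAxis {s : ℕ} (π : Equiv.Perm (Proc s)) :
    ∃ f₁ f₂ f₃ f₄ f₅ : Proc s → Proc s, AlongAxis 2 f₁ ∧ AlongAxis 1 f₂ ∧ AlongAxis 0 f₃ ∧
      AlongAxis 1 f₄ ∧ AlongAxis 2 f₅ ∧ ∀ p, π p = f₁ (f₂ (f₃ (f₄ (f₅ p)))) := by
  let φ := procEquiv s
  obtain ⟨g₁, g₂, g₃, h₁, h₂, h₃, hπ⟩ := exists_column_row_column ((φ.symm.trans π).trans φ)
  choose ρ hρ using exists_perm_plane h₂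
  choose k₁ k₂ k₃ hk₁ hk₂ hk₃ hk using fun z => exists_column_row_column (ρ z)
  refine ⟨fun p => φ.symm (g₁ (φ p)), planewise fun z => k₁ z, planewise fun z => k₂ z,
    planewise fun z => k₃ z, fun p => φ.symm (g₃ (φ p)), alongAxis_two h₁,
    alongAxis_one_planewise hk₁, alongAxis_zero_planewise hk₂, alongAxis_one_planewise hk₃,
    alongAxis_two h₃, fun p => ?_⟩
  have hmid (q) : planewise (fun z => k₁ z) (planewise (fun z => k₂ z)
      (planewise (fun z => k₃ z) (φ.symm q))) = φ.symm (g₂ q) := by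
    change φ.symm (k₁ q.2 (k₂ q.2 (k₃ q.2 q.1)), q.2) = _
    rw [← hk, hρ]
    exact congrArg φ.symm (Prod.ext rfl (h₂ q).symm)
  have hp := hπ (φ p)
  simp only [Equiv.trans_apply, Equiv.symm_apply_apply] at hp
  rw [hmid]
  simp [← hp]

/-! ### Schedules -/

/-- The contents of all registers of the mesh, without the control states. -/
abbrev Regs (s R : ℕ) (V : Type*) := Proc s → Fin R → Option V

/-- The operation denoted by an `OpKind`. -/
def OpKind.fn {V : Type*} (add mul : V → V → V) : OpKind → V → V → V
  | .plus => add
  | .times => mul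

section Schedule

variable {s R n : ℕ} {V W : Type*}

/-- The word that `p` receives from direction `d` when every processor `q` carries out `g q`. -/
def receive (g : Proc s → Action R) (σ : Regs s R V) (p : Proc s) (d : Dir) : Option V :=
  (nbr p d).bind fun q => ((g q).send d.opp).bind fun r => σ q r

/-- The registers after the communication half of a step in which every `q` carries out `g q`. -/
def loadRegs (g : Proc s → Action R) (σ : Regs s R V) : Regs s R V := fun p r =>
  match (g p).load r with
  | .own r' => σ p r'
  | .inbox d => receive g σ p d
  | .clear => none

/-- The registers after a step in which every processor `q` carries out `g q`. -/
def execStep (add mul : V → V → V) (g : Proc s → Action R) (σ : Regs s R V) : Regs s R V := fun p =>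
  match (g p).op with
  | none => loadRegs g σ p
  | some I => update (loadRegs g σ p) I.dest
      (Option.map₂ (I.kind.fn add mul) (loadRegs g σ p I.left) (loadRegs g σ p I.right))

/-- The registers after `t` steps of the schedule `G`, which prescribes the action `G t p` to the
processor `p` at the time `t`. -/
def runSchedule (add mul : V → V → V) (G : ℕ → Proc s → Action R) (σ : Regs s R V) : ℕ → Regs s R V
  | 0 => σ
  | t + 1 => execStep add mul (G t) (runSchedule add mul G σ t)

/-- Application of a map to the contents of all registers. -/
def mapRegs (φ : V → W) (σ : Regs s R V) : Regs s R W :=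
  fun p r => (σ p r).map φ

lemma receive_mapRegs (φ : V → W) (g : Proc s → Action R) (σ : Regs s R V) (p : Proc s) (d : Dir) :
    receive g (mapRegs φ σ) p d = (receive g σ p d).map φ := by
  simp only [receive, mapRegs]
  cases nbr p d with
  | none => rfl
  | some q => cases h : (g q).send d.opp <;> simp [h]

lemma loadRegs_mapRegs (φ : V → W) (g : Proc s → Action R) (σ : Regs s R V) :
    loadRegs g (mapRegs φ σ) = mapRegs φ (loadRegs g σ) := by
  funext p r
  simp only [loadRegs, mapRegs]
  cases (g p).load r with
  | own r' => rfl
  | clear => rfl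
  | inbox d => exact receive_mapRegs φ g σ p d

section Hom

variable {add mul : V → V → V} {add' mul' : W → W → W} {φ : V → W}
  (hadd : ∀ x y, φ (add x y) = add' (φ x) (φ y)) (hmul : ∀ x y, φ (mul x y) = mul' (φ x) (φ y))

include hadd hmul

lemma OpKind.map_fn (o : OpKind) (x y : V) : φ (o.fn add mul x y) = o.fn add' mul' (φ x) (φ y) := by
  cases o
  exacts [hadd x y, hmul x y]

lemma execStep_mapRegs (g : Proc s → Action R) (σ : Regs s R V) :
    execStep add' mul' g (mapRegs φ σ) = mapRegs φ (execStep add mul g σ) := by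
  funext p r
  simp only [mapRegs, execStep, loadRegs_mapRegs]
  cases (g p).op with
  | none => rfl
  | some I =>
    by_cases hr : r = I.dest
    · subst hr
      simp only [update_self]
      rw [Option.map_map₂_distrib (OpKind.map_fn hadd hmul I.kind)]
    · simp only [update_of_ne hr, mapRegs]

lemma runSchedule_mapRegs (G : ℕ → Proc s → Action R) (σ : Regs s R V) (t : ℕ) :
    runSchedule add' mul' G (mapRegs φ σ) t = mapRegs φ (runSchedule add mul G σ t) := by
  induction t with
  | zero => rfl
  | succ t ih => simp only [runSchedule, ih, execStep_mapRegs hadd hmul]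

end Hom

lemma runSchedule_succ' (add mul : V → V → V) (G : ℕ → Proc s → Action R) (σ : Regs s R V) (t : ℕ) :
    runSchedule add mul G σ (t + 1) =
      runSchedule add mul (fun t => G (t + 1)) (execStep add mul (G 0) σ) t := by
  induction t with
  | zero => rfl
  | succ t ih => rw [runSchedule, ih, runSchedule]

/-- The action that changes nothing. -/
def Action.idle (R : ℕ) : Action R := ⟨fun _ => none, .own, none⟩

lemma runSchedule_idle (add mul : V → V → V) (σ : Regs s R V) (t : ℕ) :
    runSchedule add mul (fun _ _ => Action.idle R) σ t = σ := by
  induction t with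
  | zero => rfl
  | succ t ih =>
    rw [runSchedule, ih]
    rfl

lemma execStep_of_op_none {add mul : V → V → V} {g : Proc s → Action R} {σ : Regs s R V}
    {p : Proc s} (h : (g p).op = none) : execStep add mul g σ p = loadRegs g σ p := by
  simp only [execStep, h]

end Schedule

/-! ### Reachability by operations of Algorithm A -/

section Reach

variable {s R n : ℕ}

/-- Contents of the registers that are formal expressions. -/
abbrev TermRegs (n s R : ℕ) := Regs s R (Term n)

/-- One step on formal expressions. -/
abbrev termStep (g : Proc s → Action R) (σ : TermRegs n s R) : TermRegs n s R :=
  execStep Term.plus Term.times g σ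

/-- All operations carried out in a step are those of Algorithm A with `d` levels. -/
def StepAllowed (d : ℕ) (g : Proc s → Action R) (σ : TermRegs n s R) : Prop :=
  ∀ p I u v, (g p).op = some I → loadRegs g σ p I.left = some u →
    loadRegs g σ p I.right = some v →
    (I.kind = .times → AllowedTimes d p u v) ∧ (I.kind = .plus → AllowedPlus d p u v)

/-- From `σ` a state with the property `Q` can be reached within `T` steps, by operations of
Algorithm A with `d` levels only. -/
inductive Reach (d : ℕ) (Q : TermRegs n s R → Prop) : ℕ → TermRegs n s R → Prop
  | done {T : ℕ} {σ : TermRegs n s R} (h : Q σ) : Reach d Q T σ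
  | step {T : ℕ} {σ : TermRegs n s R} (g : Proc s → Action R) (hg : StepAllowed d g σ)
      (h : Reach d Q T (termStep g σ)) : Reach d Q (T + 1) σ

variable {d : ℕ} {Q Q' : TermRegs n s R → Prop} {σ : TermRegs n s R} {T T' : ℕ}

lemma StepAllowed.of_op_none {g : Proc s → Action R} (h : ∀ p, (g p).op = none) :
    StepAllowed d g σ := fun p I u v hI => by simp [h] at hI

lemma Reach.mono (h : Reach d Q T σ) (hT : T ≤ T') : Reach d Q T' σ := by
  induction h generalizing T' with
  | done h => exact .done h
  | step g hg _ ih =>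
    obtain ⟨T', rfl⟩ := Nat.exists_eq_add_of_le' (Nat.one_le_of_lt hT)
    exact .step g hg (ih (Nat.le_of_succ_le_succ hT))

lemma Reach.bind (h : Reach d Q T σ) (h' : ∀ τ, Q τ → Reach d Q' T' τ) :
    Reach d Q' (T + T') σ := by
  induction h with
  | done hQ => exact (h' _ hQ).mono (Nat.le_add_left _ _)
  | step g hg _ ih =>
    rw [Nat.add_right_comm]
    exact .step g hg ih

lemma Reach.weaken (h : Reach d Q T σ) (hT : T ≤ T') (hQ : ∀ τ, Q τ → Q' τ) :
    Reach d Q' T' σ :=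
  (h.bind (T' := 0) fun τ hτ => .done (hQ τ hτ)).mono hT

lemma Reach.loop_sum {Inv : ℕ → TermRegs n s R → Prop} (N : ℕ) (cost : ℕ → ℕ)
    (hbody : ∀ i < N, ∀ τ, Inv i τ → Reach d (Inv (i + 1)) (cost i) τ) (h0 : Inv 0 σ) :
    Reach d (Inv N) (∑ i ∈ range N, cost i) σ := by
  induction N with
  | zero => exact .done h0
  | succ N ih =>
    rw [sum_range_succ]
    exact (ih fun i hi => hbody i (hi.trans N.lt_succ_self)).bind (hbody N N.lt_succ_self)

lemma Reach.loop {Inv : ℕ → TermRegs n s R → Prop} (N : ℕ)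
    (hbody : ∀ i < N, ∀ τ, Inv i τ → Reach d (Inv (i + 1)) T τ) (h0 : Inv 0 σ) :
    Reach d (Inv N) (N * T) σ := by
  simpa using Reach.loop_sum N (fun _ => T) hbody h0

lemma Reach.exists_schedule (h : Reach d Q T σ) :
    ∃ G : ℕ → Proc s → Action R,
      (∀ t < T, StepAllowed d (G t) (runSchedule Term.plus Term.times G σ t)) ∧
      Q (runSchedule Term.plus Term.times G σ T) := by
  induction h with
  | done hQ =>
    exact ⟨fun _ _ => Action.idle R, fun t _ => .of_op_none fun _ => rfl, by
      rwa [runSchedule_idle]⟩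
  | step g hg _ ih =>
    obtain ⟨G, hG, hQ⟩ := ih
    refine ⟨fun t => Nat.casesOn t g G, fun t ht => ?_, by rwa [runSchedule_succ']⟩
    cases t with
    | zero => exact hg
    | succ t =>
      rw [runSchedule_succ']
      exact hG t (Nat.lt_of_succ_lt_succ ht)

end Reach

/-! ### Evaluation of formal expressions -/

section Eval

variable {V : Type*} {n : ℕ} {add mul : V → V → V}

/-- The value of a formal expression. -/
def Term.eval (add mul : V → V → V) (A B : Matrix (Fin n) (Fin n) V) : Term n → V
  | .entryA i k => A i k
  | .entryB k j => B k j
  | .plus u v => add (u.eval add mul A B) (v.eval add mul A B)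
  | .times u v => mul (u.eval add mul A B) (v.eval add mul A B)

lemma foldl_add_left (hadd : ∀ x y z, add (add x y) z = add x (add y z)) (l : List V) (x y : V) :
    l.foldl add (add x y) = add x (l.foldl add y) :=
  haveI : Std.Associative add := ⟨hadd⟩
  List.foldl_assoc

lemma orderedSum_append (hadd : ∀ x y z, add (add x y) z = add x (add y z)) {l l' : List V}
    {a b : V} (hl : orderedSum add l = some a) (hl' : orderedSum add l' = some b) :
    orderedSum add (l ++ l') = some (add a b) := by
  match l, l', hl, hl' with
  | x :: xs, y :: ys, rfl, rfl => simp [orderedSum, foldl_add_left hadd]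

lemma PartialSum.lt {i j : Fin n} {lo hi : ℕ} {u : Term n} (h : PartialSum i j lo hi u) :
    lo < hi := by
  induction h with
  | single k => exact Nat.lt_succ_self k
  | plus _ _ ihu ihv => exact ihu.trans ihv

lemma PartialSum.orderedSum_eq (hadd : ∀ x y z, add (add x y) z = add x (add y z))
    {A B : Matrix (Fin n) (Fin n) V} {i j : Fin n} {f : ℕ → V}
    (hf : ∀ k : Fin n, f k = mul (A i k) (B k j)) {lo hi : ℕ} {u : Term n}
    (h : PartialSum i j lo hi u) :
    orderedSum add ((List.range' lo (hi - lo)).map f) = some (u.eval add mul A B) := by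
  induction h with
  | single k => simp [orderedSum, Term.eval, hf]
  | @plus lo mid hi u v hu hv ihu ihv =>
    have hsplit : List.range' lo (hi - lo) =
        List.range' lo (mid - lo) ++ List.range' mid (hi - mid) := by
      have happend := List.range'_append (s := lo) (m := mid - lo) (n := hi - mid) (step := 1)
      rw [one_mul, Nat.add_sub_cancel' hu.lt.le] at happend
      rw [happend, add_comm, Nat.sub_add_sub_cancel hv.lt.le hu.lt.le]
    rw [hsplit, List.map_append, orderedSum_append hadd ihu ihv]
    rfl

lemma PartialSum.generalProduct_eq (hadd : ∀ x y z, add (add x y) z = add x (add y z))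
    (A B : Matrix (Fin n) (Fin n) V) {i j : Fin n} {u : Term n} (h : PartialSum i j 0 n u) :
    generalProduct add mul A B i j = some (u.eval add mul A B) := by
  let f : ℕ → V := fun k => if hk : k < n then mul (A i ⟨k, hk⟩) (B ⟨k, hk⟩ j) else A i i
  have hf (k : Fin n) : f k = mul (A i k) (B k j) := by simp [f]
  rw [← h.orderedSum_eq hadd hf, generalProduct, Nat.sub_zero, ← List.range_eq_range',
    ← List.map_coe_finRange_eq_range, List.map_map]
  exact congrArg _ (List.map_congr_left fun k _ => (hf k).symm)

end Eval

/-! ### The program of a schedule -/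

section ScheduleProgram

variable {s R w T n : ℕ}

/-- The program that follows a schedule for `T` steps: the control state consists of the
coordinates of the processor and a clock. -/
def scheduleProgram (G : ℕ → Proc s → Action R) (hw : s ^ 3 * (T + 1) ≤ (s ^ 3 + 2) ^ w)
    (rA rB rC : Fin R) (hAB : rA ≠ rB) : Program s R w where
  Ctrl := Proc s × Fin (T + 1)
  finite_ctrl := inferInstance
  card_ctrl := by simpa using hw
  init p := (p, 0)
  act q := G q.2 q.1
  next q _ _ _ := (q.1, ⟨min (q.2 + 1) T, by omega⟩)
  halted q := decide ((q.2 : ℕ) = T)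
  regA := rA
  regB := rB
  regC := rC
  regA_ne_regB := hAB

/-- The initial registers, with `A` in the register `rA` and `B` in `rB`. -/
noncomputable def initialRegs {V : Type*} (rA rB : Fin R) (LA LB : Layout n s)
    (A B : Matrix (Fin n) (Fin n) V) : Regs s R V :=
  fun p r => if r = rA then stored LA A p else if r = rB then stored LB B p else none

variable {G : ℕ → Proc s → Action R} {hw : s ^ 3 * (T + 1) ≤ (s ^ 3 + 2) ^ w}
  {rA rB rC : Fin R} {hAB : rA ≠ rB} {LA LB LC : Layout n s} {V : Type*}

lemma scheduleProgram_run (add mul : V → V → V) (A B : Matrix (Fin n) (Fin n) V) {t : ℕ}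
    (ht : t ≤ T) :
    (scheduleProgram G hw rA rB rC hAB).run add mul LA LB A B t =
      ⟨fun p => (p, ⟨t, Nat.lt_succ_of_le ht⟩),
        runSchedule add mul G (initialRegs rA rB LA LB A B) t⟩ := by
  induction t with
  | zero => rfl
  | succ t ih =>
    rw [Program.run, iterate_succ_apply', ← Program.run, ih (Nat.le_of_succ_le ht)]
    unfold Program.step
    congr 1
    funext p
    exact Prod.ext rfl (Fin.ext (min_eq_left ht))

lemma scheduleProgram_allHalted_iff (hs : 0 < s) (add mul : V → V → V)
    (A B : Matrix (Fin n) (Fin n) V) {t : ℕ} (ht : t ≤ T) :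
    (scheduleProgram G hw rA rB rC hAB).AllHalted
      ((scheduleProgram G hw rA rB rC hAB).run add mul LA LB A B t) ↔ t = T := by
  rw [scheduleProgram_run add mul A B ht]
  simp only [Program.AllHalted, scheduleProgram, decide_eq_true_eq]
  exact ⟨fun h => h fun _ => ⟨0, hs⟩, fun h _ => h⟩

lemma scheduleProgram_haltsAt (hs : 0 < s) (add mul : V → V → V) (A B : Matrix (Fin n) (Fin n) V) :
    (scheduleProgram G hw rA rB rC hAB).HaltsAt add mul LA LB A B T :=
  ⟨(scheduleProgram_allHalted_iff hs _ _ _ _ le_rfl).2 rfl, fun _ ht h =>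
    ht.ne ((scheduleProgram_allHalted_iff hs _ _ _ _ ht.le).1 h)⟩

lemma initialRegs_eval (add mul : V → V → V) (A B : Matrix (Fin n) (Fin n) V) :
    (initialRegs rA rB LA LB A B : Regs s R V) = mapRegs (Term.eval add mul A B)
      (initialRegs rA rB LA LB (Matrix.of Term.entryA) (Matrix.of Term.entryB)) := by
  funext p r
  simp only [initialRegs, mapRegs]
  split_ifs
  · simp [stored, comp_def, Term.eval]
  · simp [stored, comp_def, Term.eval]
  · rfl

/-- The property of the registers that the layout `L` holds the product matrix in `r`. -/
def ProductStored (L : Layout n s) (r : Fin R) (σ : TermRegs n s R) : Prop :=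
  ∀ i j, ∃ u, σ (L (i, j)) r = some u ∧ PartialSum i j 0 n u

lemma scheduleProgram_followsAlgorithmA (hs : 0 < s) {d : ℕ}
    (hG : ∀ t < T, StepAllowed d (G t) (runSchedule Term.plus Term.times G
      (initialRegs rA rB LA LB (Matrix.of Term.entryA) (Matrix.of Term.entryB)) t)) :
    (scheduleProgram G hw rA rB rC hAB).FollowsAlgorithmA LA LB d := by
  refine ⟨fun _ _ _ _ _ _ => rfl, fun t ht p u v => ?_⟩
  have htT : t < T := lt_of_not_ge fun hTt =>
    ht T hTt ((scheduleProgram_allHalted_iff hs _ _ _ _ le_rfl).2 rfl)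
  rw [scheduleProgram_run _ _ _ _ htT.le]
  exact ⟨fun ⟨I, hI, hkind, hu, hv⟩ => (hG t htT p I u v hI hu hv).1 hkind,
    fun ⟨I, hI, hkind, hu, hv⟩ => (hG t htT p I u v hI hu hv).2 hkind⟩

lemma scheduleProgram_computesWithin (hs : 0 < s)
    (hC : ProductStored LC rC (runSchedule Term.plus Term.times G
      (initialRegs rA rB LA LB (Matrix.of Term.entryA) (Matrix.of Term.entryB)) T)) :
    Program.ComputesWithin.{u} (scheduleProgram G hw rA rB rC hAB) LA LB LC T := by
  refine fun V add mul hadd A B => ⟨T, le_rfl, scheduleProgram_haltsAt hs add mul A B,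
    fun i j => ?_⟩
  obtain ⟨u, hu, hsum⟩ := hC i j
  rw [scheduleProgram_run _ _ _ _ le_rfl, initialRegs_eval add mul,
    runSchedule_mapRegs (add := Term.plus) (mul := Term.times) (fun _ _ => rfl) (fun _ _ => rfl),
    hsum.generalProduct_eq hadd A B]
  simp only [mapRegs, scheduleProgram, hu, Option.map_some]

lemma le_of_scheduleProgram_computesWithin (hs : 0 < s) {T' : ℕ}
    (h : Program.ComputesWithin.{u} (scheduleProgram G hw rA rB rC hAB) LA LB LC T') : T ≤ T' := by
  obtain ⟨t, htT', ⟨hhalt, -⟩, -⟩ := h PUnit (fun _ _ => ⟨⟩) (fun _ _ => ⟨⟩) (fun _ _ _ => rfl)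
    (fun _ _ => ⟨⟩) (fun _ _ => ⟨⟩)
  by_contra! hlt
  have heq := (scheduleProgram_allHalted_iff hs _ _ _ _ (htT'.trans hlt.le)).1 hhalt
  omega

lemma exists_program_of_reach (hs : 0 < s) {d : ℕ} (hw : s ^ 3 * (T + 1) ≤ (s ^ 3 + 2) ^ w)
    (hAB : rA ≠ rB)
    (h : Reach d (ProductStored LC rC) T
      (initialRegs rA rB LA LB (Matrix.of Term.entryA) (Matrix.of Term.entryB))) :
    ∃ P : Program s R w, P.FollowsAlgorithmA LA LB d ∧
      IsLeast {T' : ℕ | Program.ComputesWithin.{u} P LA LB LC T'} T := by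
  obtain ⟨G, hG, hC⟩ := h.exists_schedule
  exact ⟨scheduleProgram G hw rA rB rC hAB, scheduleProgram_followsAlgorithmA hs hG,
    scheduleProgram_computesWithin hs hC, fun _ => le_of_scheduleProgram_computesWithin hs⟩

end ScheduleProgram

/-! ### Routing -/

section Routing

variable {s R n d : ℕ}

/-- The processor reached from `p` by `t` moves in direction `e`. -/
def walk (p : Proc s) (e : Dir) : ℕ → Option (Proc s)
  | 0 => some p
  | t + 1 => (nbr p e).bind fun q => walk q e t

/-- `q` lies `t` moves from `p` in direction `e`. -/
def Ahead (e : Dir) (t : ℕ) (p q : Proc s) : Prop :=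
  (∀ b, b ≠ e.1 → q b = p b) ∧
    if e.2 then (p e.1 : ℕ) + t = q e.1 else (q e.1 : ℕ) + t = p e.1

lemma Ahead.eq {e : Dir} {p q : Proc s} (h : Ahead e 0 p q) : p = q := by
  funext b
  obtain rfl | hb := eq_or_ne b e.1
  · obtain ⟨-, h⟩ := h
    split_ifs at h <;> exact Fin.ext (by omega)
  · exact (h.1 b hb).symm

lemma Ahead.exists_nbr {e : Dir} {t : ℕ} {p q : Proc s} (h : Ahead e (t + 1) p q) :
    ∃ p', nbr p e = some p' ∧ Ahead e t p' q := by
  obtain ⟨a, _ | _⟩ := e <;> obtain ⟨hb, ha⟩ := h <;>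
    simp only [Bool.false_eq_true, if_false, if_true] at hb ha
  · have hne : (p a : ℕ) ≠ 0 := by omega
    refine ⟨update p a ⟨(p a : ℕ) - 1, (Nat.sub_le _ _).trans_lt (p a).isLt⟩, by simp [nbr, hne],
      fun b hba => by simp only [hb b hba, update_of_ne hba], ?_⟩
    simp only [Bool.false_eq_true, if_false, update_self]
    omega
  · have hlt : (p a : ℕ) + 1 < s := by omega
    refine ⟨update p a ⟨(p a : ℕ) + 1, hlt⟩, by simp [nbr, hlt],
      fun b hba => by simp only [hb b hba, update_of_ne hba], ?_⟩
    simp only [if_true, update_self]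
    omega

lemma Ahead.walk_eq {e : Dir} {t : ℕ} {p q : Proc s} (h : Ahead e t p q) :
    walk p e t = some q := by
  induction t generalizing p with
  | zero => rw [walk, h.eq]
  | succ t ih =>
    obtain ⟨p', hp', h'⟩ := h.exists_nbr
    rw [walk, hp', Option.bind_some, ih h']

lemma exists_walk_of_dist_le {a : Fin 3} {l : ℕ} {p q : Proc s} (hb : ∀ b, b ≠ a → q b = p b)
    (hq : (q a : ℕ) ≤ p a + l) (hp : (p a : ℕ) ≤ q a + l) :
    (∃ t ≤ l, walk p (a, false) t = some q) ∨ ∃ t ≤ l, walk p (a, true) t = some q := by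
  obtain h | h := le_total (q a : ℕ) (p a)
  · exact .inl ⟨p a - q a, by omega, Ahead.walk_eq ⟨hb, Nat.add_sub_cancel' h⟩⟩
  · exact .inr ⟨q a - p a, by omega, Ahead.walk_eq ⟨hb, Nat.add_sub_cancel' h⟩⟩

open Classical in
/-- The action that passes on the content of `tmp`, replaces it by the word from `v`, and stores
that word also in `dst` at the processors in `take`. -/
noncomputable def relay (tmp dst : Fin R) (v : Source R) (take : Proc s → Prop) (p : Proc s) :
    Action R where
  send _ := some tmp
  load r := if r = tmp ∨ r = dst ∧ take p then v else .own r
  op := none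

open Classical in
/-- The invariant of fetching in direction `e`: after `k` moves, `tmp` contains the word of the
register `src` from `k` processors ahead in the state `σ`, and those processors `p` in `M` that
have met `G p` have stored its word in `dst`. -/
structure FetchInv (e : Dir) (src dst tmp : Fin R) (M : Proc s → Prop) (G : Proc s → Proc s)
    (σ : TermRegs n s R) (k : ℕ) (τ : TermRegs n s R) : Prop where
  tmp_eq : ∀ p, τ p tmp = (walk p e k).bind fun q => σ q src
  dst_eq : ∀ p, τ p dst =
    if M p ∧ ∃ t ≤ k, walk p e t = some (G p) then σ (G p) src else σ p dst
  other_eq : ∀ p r, r ≠ dst → r ≠ tmp → τ p r = σ p r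

variable {src dst tmp : Fin R} {M : Proc s → Prop} {G : Proc s → Proc s}

lemma termStep_relay_of_not {v : Source R} {take : Proc s → Prop} {σ : TermRegs n s R} {p : Proc s}
    {r : Fin R} (h : ¬ (r = tmp ∨ r = dst ∧ take p)) :
    termStep (relay tmp dst v take) σ p r = σ p r := by
  rw [termStep, execStep_of_op_none rfl]
  simp only [loadRegs, relay, if_neg h]

lemma termStep_relay_own {r' : Fin R} {take : Proc s → Prop} {σ : TermRegs n s R} {p : Proc s}
    {r : Fin R} (h : r = tmp ∨ r = dst ∧ take p) :
    termStep (relay tmp dst (.own r') take) σ p r = σ p r' := by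
  rw [termStep, execStep_of_op_none rfl]
  simp only [loadRegs, relay, if_pos h]

lemma termStep_relay_inbox {e : Dir} {take : Proc s → Prop} {σ : TermRegs n s R} {p : Proc s}
    {r : Fin R} (h : r = tmp ∨ r = dst ∧ take p) :
    termStep (relay tmp dst (.inbox e) take) σ p r = (nbr p e).bind fun q => σ q tmp := by
  rw [termStep, execStep_of_op_none rfl]
  simp only [loadRegs, relay, if_pos h, receive, Option.bind_some]

lemma fetchInv_zero (e : Dir) (hdt : dst ≠ tmp) (σ : TermRegs n s R) :
    FetchInv e src dst tmp M G σ 0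
      (termStep (relay tmp dst (.own src) fun p => M p ∧ p = G p) σ) where
  tmp_eq p := termStep_relay_own (.inl rfl)
  dst_eq p := by
    by_cases h : M p ∧ p = G p
    · rw [termStep_relay_own (.inr ⟨rfl, h⟩), if_pos ⟨h.1, 0, le_rfl, congrArg some h.2⟩, ← h.2]
    · rw [if_neg (by simpa [walk] using h)]
      exact termStep_relay_of_not (by simp [hdt, h])
  other_eq p r hd ht := termStep_relay_of_not (by simp [hd, ht])

lemma FetchInv.succ {e : Dir} (hdt : dst ≠ tmp) {σ τ : TermRegs n s R} {k : ℕ}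
    (h : FetchInv e src dst tmp M G σ k τ) :
    FetchInv e src dst tmp M G σ (k + 1) (termStep
      (relay tmp dst (.inbox e) fun p => M p ∧ walk p e (k + 1) = some (G p)) τ) := by
  have hinbox (p : Proc s) : ((nbr p e).bind fun q => τ q tmp) =
      (walk p e (k + 1)).bind fun q => σ q src := by
    simp only [walk, h.tmp_eq, Option.bind_assoc]
  refine ⟨fun p => ?_, fun p => ?_, fun p r hd ht => ?_⟩
  · rw [termStep_relay_inbox (.inl rfl), hinbox]
  · by_cases hnow : M p ∧ walk p e (k + 1) = some (G p)
    · rw [termStep_relay_inbox (.inr ⟨rfl, hnow⟩), hinbox, hnow.2,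
        if_pos ⟨hnow.1, k + 1, le_rfl, hnow.2⟩]
      rfl
    · rw [termStep_relay_of_not (by simp [hdt, hnow]), h.dst_eq]
      congr 1
      refine propext (and_congr_right fun hM => exists_congr fun t => ?_)
      exact and_congr_left fun ht => ⟨Nat.le_succ_of_le, fun hle =>
        Nat.le_of_lt_succ (hle.lt_of_ne fun heq => hnow ⟨hM, heq ▸ ht⟩)⟩
  · rw [termStep_relay_of_not (by simp [hd, ht]), h.other_eq p r hd ht]

lemma reach_fetchInv (e : Dir) (hdt : dst ≠ tmp) (M : Proc s → Prop) (G : Proc s → Proc s)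
    (l : ℕ) (σ : TermRegs n s R) : Reach d (FetchInv e src dst tmp M G σ l) (l + 1) σ := by
  have hloop : Reach d (FetchInv e src dst tmp M G σ l) (l * 1) _ :=
    .loop l (fun k _ τ hτ => .step _ (.of_op_none fun _ => rfl) (.done (hτ.succ hdt)))
      (fetchInv_zero e hdt σ)
  exact .step _ (.of_op_none fun _ => rfl) (mul_one l ▸ hloop)

/-- `τ` arises from `σ` when the processors `p` in `M` fetch the content of the register `src` of
`G p` into `dst`; the registers in `work` may be overwritten. -/
structure Fetched (M : Proc s → Prop) (G : Proc s → Proc s) (src dst : Fin R) (work : List (Fin R))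
    (σ τ : TermRegs n s R) : Prop where
  fetched : ∀ p, M p → τ p dst = σ (G p) src
  kept : ∀ p, ¬ M p → τ p dst = σ p dst
  other : ∀ p r, r ≠ dst → r ∉ work → τ p r = σ p r

lemma reach_fetch (a : Fin 3) (hsd : src ≠ dst) (hst : src ≠ tmp) (hdt : dst ≠ tmp)
    {M : Proc s → Prop} {G : Proc s → Proc s} (l : ℕ)
    (hG : ∀ p, M p → (∀ b, b ≠ a → G p b = p b) ∧ (G p a : ℕ) ≤ p a + l ∧ (p a : ℕ) ≤ G p a + l)
    (σ : TermRegs n s R) : Reach d (Fetched M G src dst [tmp] σ) (2 * l + 2) σ := by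
  rw [show 2 * l + 2 = l + 1 + (l + 1) by ring]
  refine (reach_fetchInv (a, false) (src := src) hdt M G l σ).bind fun τ hτ =>
    (reach_fetchInv (a, true) (src := src) hdt M G l τ).weaken le_rfl fun ρ hρ => ?_
  refine ⟨fun p hp => ?_, fun p hp => ?_, fun p r hd ht => ?_⟩
  · obtain ⟨hb, hle, hge⟩ := hG p hp
    rw [hρ.dst_eq, hτ.other_eq _ _ hsd hst]
    obtain hdown | hup := exists_walk_of_dist_le hb hle hge
    · rw [hτ.dst_eq, if_pos (show M p ∧ _ from ⟨hp, hdown⟩), ite_self]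
    · rw [if_pos ⟨hp, hup⟩]
  · rw [hρ.dst_eq, if_neg (fun h => hp h.1), hτ.dst_eq, if_neg (fun h => hp h.1)]
  · have ht := List.ne_of_not_mem_cons ht
    rw [hρ.other_eq p r hd ht, hτ.other_eq p r hd ht]

lemma reach_fetch_alongAxis {a : Fin 3} {f : Proc s → Proc s} (hf : AlongAxis a f) (hsd : src ≠ dst)
    (hst : src ≠ tmp) (hdt : dst ≠ tmp) (M : Proc s → Prop) (σ : TermRegs n s R) :
    Reach d (Fetched M f src dst [tmp] σ) (2 * s + 2) σ :=
  reach_fetch a hsd hst hdt s (fun p _ => ⟨hf p, by omega, by omega⟩) σ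

lemma reach_permute (π : Equiv.Perm (Proc s)) {x y : Fin R} (hr : [src, dst, x, y, tmp].Nodup)
    (M : Proc s → Prop) (σ : TermRegs n s R) :
    Reach d (Fetched M π src dst [x, y, tmp] σ) (10 * s + 10) σ := by
  obtain ⟨f₁, f₂, f₃, f₄, f₅, h₁, h₂, h₃, h₄, h₅, hπ⟩ := exists_five_alongAxis π
  simp only [List.nodup_cons, List.mem_cons, List.not_mem_nil, or_false, not_or] at hr
  obtain ⟨⟨-, hsx, -, hst⟩, ⟨hdx, hdy, hdt⟩, ⟨hxy, hxt⟩, hyt, -⟩ := hr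
  rw [show 10 * s + 10 = 2 * s + 2 + (2 * s + 2 + (2 * s + 2 + (2 * s + 2 + (2 * s + 2)))) by ring]
  refine (reach_fetch_alongAxis h₁ hsx hst hxt (fun _ => True) σ).bind fun σ₁ e₁ =>
    (reach_fetch_alongAxis h₂ hxy hxt hyt (fun _ => True) σ₁).bind fun σ₂ e₂ =>
    (reach_fetch_alongAxis h₃ (Ne.symm hxy) hyt hxt (fun _ => True) σ₂).bind fun σ₃ e₃ =>
    (reach_fetch_alongAxis h₄ hxy hxt hyt (fun _ => True) σ₃).bind fun σ₄ e₄ =>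
    (reach_fetch_alongAxis h₅ (Ne.symm hdy) hyt hdt M σ₄).weaken le_rfl fun σ₅ e₅ => ?_
  have hother (p : Proc s) (r : Fin R) (hx : r ≠ x) (hy : r ≠ y) (ht : r ∉ [tmp]) :
      σ₄ p r = σ p r := by
    rw [e₄.other _ _ hy ht, e₃.other _ _ hx ht, e₂.other _ _ hy ht, e₁.other _ _ hx ht]
  refine ⟨fun p hp => ?_, fun p hp => ?_, fun p r hd hr => ?_⟩
  · rw [e₅.fetched p hp, e₄.fetched _ trivial, e₃.fetched _ trivial, e₂.fetched _ trivial,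
      e₁.fetched _ trivial, ← hπ]
  · rw [e₅.kept p hp, hother p dst hdx hdy (by simpa using hdt)]
  · simp only [List.mem_cons, List.not_mem_nil, or_false, not_or] at hr
    obtain ⟨hx, hy, ht⟩ := hr
    rw [e₅.other _ _ hd (by simpa using ht), hother p r hx hy (by simpa using ht)]

/-- The state after a step in which every processor performs the operation `op p`, if any, on its
own registers. -/
def applyOps (op : Proc s → Option (Instr R)) (σ : TermRegs n s R) : TermRegs n s R :=
  termStep (fun p => ⟨fun _ => none, .own, op p⟩) σ

lemma reach_applyOps {op : Proc s → Option (Instr R)} {σ : TermRegs n s R}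
    (hop : StepAllowed d (fun p => ⟨fun _ => none, .own, op p⟩) σ) :
    Reach d (· = applyOps op σ) 1 σ :=
  .step _ hop (.done rfl)

end Routing

/-! ### Blocks of index ranges -/

section Blocks

/-- The first element of the part with number `K` if `0, …, N - 1` is divided into `D` parts. -/
def blockStart (D N K : ℕ) : ℕ := (K * N + (D - 1)) / D

variable {D N K K' x d : ℕ}

lemma blockStart_le_iff (hD : 0 < D) (hN : 0 < N) : blockStart D N K ≤ x ↔ K ≤ D * x / N := by
  rw [blockStart, Nat.le_div_iff_mul_le hN, ← Nat.lt_succ_iff, Nat.div_lt_iff_lt_mul hD]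
  constructor <;> intro h <;> nlinarith [Nat.sub_add_cancel hD]

lemma lt_blockStart_iff (hD : 0 < D) (hN : 0 < N) : x < blockStart D N K ↔ D * x / N < K := by
  rw [← not_le, blockStart_le_iff hD hN, not_le]

lemma blockStart_zero : blockStart D N 0 = 0 := by
  rcases Nat.eq_zero_or_pos D with rfl | hD
  · simp [blockStart]
  · simp [blockStart, hD]

lemma blockStart_self (hD : 0 < D) : blockStart D N D = N := by
  rw [blockStart, Nat.mul_add_div hD, Nat.div_eq_of_lt (by omega), add_zero]

lemma blockStart_mono (h : K ≤ K') : blockStart D N K ≤ blockStart D N K' :=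
  Nat.div_le_div_right (by gcongr)

lemma blockStart_add_div_le : blockStart D N K + N / D ≤ blockStart D N (K + 1) := by
  unfold blockStart
  refine le_trans Nat.div_add_div_le_add_div (Nat.div_le_div_right ?_)
  ring_nf
  omega

lemma blockStart_add_le (hD : 0 < D) (c : ℕ) :
    blockStart D N (K + c) ≤ blockStart D N K + c * N / D + 1 := by
  rw [blockStart, blockStart, add_mul, add_right_comm, Nat.add_div hD]
  split_ifs <;> omega

lemma blockStart_lt_succ (hD : 0 < D) (h : D ≤ N) : blockStart D N K < blockStart D N (K + 1) := by
  have hle := blockStart_add_div_le (D := D) (N := N) (K := K)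
  have hpos := Nat.div_pos h hD
  omega

lemma part_eq_iff (hN : 0 < N) :
    part N d x = K ↔ blockStart (2 ^ d) N K ≤ x ∧ x < blockStart (2 ^ d) N (K + 1) := by
  rw [blockStart_le_iff (by positivity) hN, lt_blockStart_iff (by positivity) hN, part]
  omega

lemma part_lt (hx : x < N) : part N d x < 2 ^ d := by
  rw [part, Nat.div_lt_iff_lt_mul (by omega)]
  exact Nat.mul_lt_mul_of_pos_left hx (by positivity)

lemma part_of_le {r : ℕ} (hr : r ≤ d) : part N r x = part N d x / 2 ^ (d - r) := by
  obtain ⟨e, rfl⟩ := Nat.exists_eq_add_of_le hr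
  rw [part, part, Nat.div_div_eq_div_mul, Nat.add_sub_cancel_left, pow_add,
    mul_comm (2 ^ r) (2 ^ e), mul_comm N, mul_assoc, Nat.mul_div_mul_left _ _ (by positivity)]

end Blocks

/-! ### The subcubes -/

section Subcubes

variable {s d : ℕ}

/-- The edge length of the part of a subcube that is used, after `d` halvings; an edge may be longer
by one, and the surplus is left idle. -/
def subEdge (s d : ℕ) : ℕ := s / 2 ^ d

/-- The number of the subcube of `p` on the axis `a`. -/
def blk (d : ℕ) (p : Proc s) (a : Fin 3) : ℕ := part s d (p a)

/-- The coordinate of `p` on the axis `a` within its subcube. -/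
def loc (d : ℕ) (p : Proc s) (a : Fin 3) : ℕ := p a - blockStart (2 ^ d) s (blk d p a)

/-- The processor with the coordinate `x` within the subcube `K` on the axis `a`, and the other
coordinates as for `p`. -/
def place (d : ℕ) (p : Proc s) (a : Fin 3) (K x : ℕ) : Proc s :=
  if h : blockStart (2 ^ d) s K + x < s then update p a ⟨_, h⟩ else p

/-- The processor with coordinate `x` on the axis `a` in the subcube of `p`. -/
def setLoc (d : ℕ) (p : Proc s) (a : Fin 3) (x : ℕ) : Proc s := place d p a (blk d p a) x

lemma pos_of_proc (p : Proc s) : 0 < s := (p 0).pos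

lemma blk_lt (p : Proc s) (a : Fin 3) : blk d p a < 2 ^ d := part_lt (p a).isLt

lemma blockStart_add_loc (p : Proc s) (a : Fin 3) :
    blockStart (2 ^ d) s (blk d p a) + loc d p a = p a :=
  Nat.add_sub_cancel' ((part_eq_iff (pos_of_proc p)).1 rfl).1

lemma blockStart_add_lt {K x : ℕ} (hK : K < 2 ^ d) (hx : x < subEdge s d) :
    blockStart (2 ^ d) s K + x < s := by
  have hle := blockStart_add_div_le (D := 2 ^ d) (N := s) (K := K)
  have hend := blockStart_mono (D := 2 ^ d) (N := s) (show K + 1 ≤ 2 ^ d from hK)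
  rw [blockStart_self (by positivity)] at hend
  unfold subEdge at hx
  omega

lemma place_self (p : Proc s) {a : Fin 3} {K x : ℕ} (hK : K < 2 ^ d) (hx : x < subEdge s d) :
    (place d p a K x a : ℕ) = blockStart (2 ^ d) s K + x := by
  rw [place, dif_pos (blockStart_add_lt hK hx), update_self]

lemma place_of_ne (p : Proc s) {a b : Fin 3} (K x : ℕ) (h : b ≠ a) : place d p a K x b = p b := by
  unfold place
  split_ifs
  · exact update_of_ne h _ _
  · rfl

lemma blk_place_self (p : Proc s) {a : Fin 3} {K x : ℕ} (hK : K < 2 ^ d) (hx : x < subEdge s d) :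
    blk d (place d p a K x) a = K := by
  rw [blk, part_eq_iff (pos_of_proc p), place_self p hK hx]
  have hle := blockStart_add_div_le (D := 2 ^ d) (N := s) (K := K)
  unfold subEdge at hx
  omega

lemma loc_place_self (p : Proc s) {a : Fin 3} {K x : ℕ} (hK : K < 2 ^ d) (hx : x < subEdge s d) :
    loc d (place d p a K x) a = x := by
  rw [loc, blk_place_self p hK hx, place_self p hK hx, Nat.add_sub_cancel_left]

lemma blk_place_of_ne (p : Proc s) {a b : Fin 3} (K x : ℕ) (h : b ≠ a) :
    blk d (place d p a K x) b = blk d p b := by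
  rw [blk, place_of_ne p K x h, blk]

lemma loc_place_of_ne (p : Proc s) {a b : Fin 3} (K x : ℕ) (h : b ≠ a) :
    loc d (place d p a K x) b = loc d p b := by
  rw [loc, blk_place_of_ne p K x h, place_of_ne p K x h, loc]

lemma loc_setLoc_self (p : Proc s) {a : Fin 3} {x : ℕ} (hx : x < subEdge s d) :
    loc d (setLoc d p a x) a = x := loc_place_self p (blk_lt p a) hx

lemma loc_setLoc_of_ne (p : Proc s) {a b : Fin 3} (x : ℕ) (h : b ≠ a) :
    loc d (setLoc d p a x) b = loc d p b := loc_place_of_ne p _ x h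

lemma blk_setLoc (p : Proc s) (a b : Fin 3) {x : ℕ} (hx : x < subEdge s d) :
    blk d (setLoc d p a x) b = blk d p b := by
  obtain rfl | h := eq_or_ne b a
  · exact blk_place_self p (blk_lt p b) hx
  · exact blk_place_of_ne p _ x h

lemma proc_ext {p q : Proc s} (h : ∀ a, blk d p a = blk d q a) (h' : ∀ a, loc d p a = loc d q a) :
    p = q := by
  funext a
  ext
  rw [← blockStart_add_loc (d := d) p a, ← blockStart_add_loc (d := d) q a, h, h']

lemma setLoc_loc (p : Proc s) (a : Fin 3) (h : loc d p a < subEdge s d) :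
    setLoc d p a (loc d p a) = p := by
  refine proc_ext (d := d) (fun b => blk_setLoc p a b h) fun b => ?_
  obtain rfl | hb := eq_or_ne b a
  · exact loc_setLoc_self p h
  · exact loc_setLoc_of_ne p _ hb

lemma setLoc_setLoc (p : Proc s) (a : Fin 3) {x y : ℕ} (hx : x < subEdge s d)
    (hy : y < subEdge s d) : setLoc d (setLoc d p a x) a y = setLoc d p a y := by
  refine proc_ext (d := d) (fun b => ?_) fun b => ?_
  · rw [blk_setLoc _ a b hy, blk_setLoc _ a b hx, blk_setLoc _ a b hy]
  · obtain rfl | hb := eq_or_ne b a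
    · rw [loc_setLoc_self _ hy, loc_setLoc_self _ hy]
    · rw [loc_setLoc_of_ne _ _ hb, loc_setLoc_of_ne _ _ hb, loc_setLoc_of_ne _ _ hb]

lemma ahead_setLoc_up (p : Proc s) {a : Fin 3} {x t : ℕ} (hx : x < subEdge s d)
    (h : loc d p a + t = x) : Ahead (a, true) t p (setLoc d p a x) := by
  have hplace : (setLoc d p a x a : ℕ) = _ := place_self p (blk_lt p a) hx
  have hloc := blockStart_add_loc (d := d) p a
  exact ⟨fun b hb => place_of_ne p _ _ hb, show (p a : ℕ) + t = setLoc d p a x a by omega⟩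

lemma ahead_setLoc_down (p : Proc s) {a : Fin 3} {x t : ℕ} (hx : x < subEdge s d)
    (h : x + t = loc d p a) : Ahead (a, false) t p (setLoc d p a x) := by
  have hplace : (setLoc d p a x a : ℕ) = _ := place_self p (blk_lt p a) hx
  have hloc := blockStart_add_loc (d := d) p a
  exact ⟨fun b hb => place_of_ne p _ _ hb, show (setLoc d p a x a : ℕ) + t = p a by omega⟩

lemma nbr_up_eq_setLoc (p : Proc s) (a : Fin 3) (h : loc d p a + 1 < subEdge s d) :
    nbr p (a, true) = some (setLoc d p a (loc d p a + 1)) := by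
  simpa [walk] using (ahead_setLoc_up p h rfl).walk_eq

lemma nbr_down_eq_setLoc (p : Proc s) (a : Fin 3) (h : loc d p a < subEdge s d)
    (h0 : loc d p a ≠ 0) : nbr p (a, false) = some (setLoc d p a (loc d p a - 1)) := by
  have hahead : Ahead (a, false) 1 p (setLoc d p a (loc d p a - 1)) :=
    ahead_setLoc_down p (by omega) (by omega)
  simpa [walk] using hahead.walk_eq

end Subcubes

/-! ### Matrix multiplication in a layer of a subcube -/

section Layer

variable {s R n d : ℕ}

/-- The contents of the register `top` in a row of the axis `a` of a subcube move down to the end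
of the row, and from there up again in the register `bot`; the row starts with a delay that is its
coordinate on the axis `b`. This is the state after `t` steps, the initial content being given by
`f`. -/
structure Conveyor (d : ℕ) (a b : Fin 3) (top bot : Fin R) (f : Proc s → Option (Term n))
    (t : ℕ) (τ : TermRegs n s R) : Prop where
  top : ∀ p k, loc d p a < subEdge s d → loc d p b < subEdge s d → k < subEdge s d →
    loc d p a + (t - loc d p b) = k → τ p top = f (setLoc d p a k)
  bot : ∀ p k, loc d p a < subEdge s d → loc d p b < subEdge s d → k < subEdge s d →
    1 + loc d p b + loc d p a + k = t → τ p bot = f (setLoc d p a k)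

lemma Conveyor.zero {a b : Fin 3} {top bot : Fin R} (τ : TermRegs n s R) :
    Conveyor d a b top bot (fun p => τ p top) 0 τ where
  top p k ha _ _ hsum := by
    obtain rfl : k = loc d p a := by omega
    rw [setLoc_loc p a ha]
  bot p k _ _ _ hsum := by omega

lemma Conveyor.congr {a b : Fin 3} {top bot : Fin R} {f : Proc s → Option (Term n)} {t : ℕ}
    {τ τ' : TermRegs n s R} (h : Conveyor d a b top bot f t τ) (ht : ∀ p, τ' p top = τ p top)
    (hb : ∀ p, τ' p bot = τ p bot) : Conveyor d a b top bot f t τ' where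
  top p k hpa hpb hk hsum := (ht p).trans (h.top p k hpa hpb hk hsum)
  bot p k hpa hpb hk hsum := (hb p).trans (h.bot p k hpa hpb hk hsum)

lemma Conveyor.succ {a b : Fin 3} (hab : b ≠ a) {top bot : Fin R} {f : Proc s → Option (Term n)}
    {t : ℕ} {τ : TermRegs n s R} (h : Conveyor d a b top bot f t τ) {g : Proc s → Action R}
    (htop : ∀ p, (g p).load top = if loc d p b ≤ t then .inbox (a, true) else .own top)
    (hbot : ∀ p, (g p).load bot = if loc d p a = 0 then .own top else .inbox (a, false))
    (hdown : ∀ p, (g p).send (a, false) = some top)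
    (hup : ∀ p, (g p).send (a, true) = some bot) :
    Conveyor d a b top bot f (t + 1) (loadRegs g τ) where
  top p k ha hb hk hsum := by
    unfold loadRegs
    rw [htop]
    by_cases ht : loc d p b ≤ t
    · have hnext : loc d p a + 1 < subEdge s d := by omega
      have hloca : loc d (setLoc d p a (loc d p a + 1)) a = loc d p a + 1 := loc_setLoc_self p hnext
      have hlocb : loc d (setLoc d p a (loc d p a + 1)) b = loc d p b := loc_setLoc_of_ne p _ hab
      simp only [ht, if_true, receive, nbr_up_eq_setLoc p a hnext, Option.bind_some]
      change ((g _).send (a, false)).bind _ = _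
      rw [hdown, Option.bind_some,
        h.top (setLoc d p a (loc d p a + 1)) k (by omega) (by omega) hk (by omega),
        setLoc_setLoc p a hnext hk]
    · simp only [ht, if_false]
      exact h.top p k ha hb hk (by omega)
  bot p k ha hb hk hsum := by
    unfold loadRegs
    rw [hbot]
    by_cases h0 : loc d p a = 0
    · simp only [h0, if_true]
      exact h.top p k ha hb hk (by omega)
    · have hprev : loc d p a - 1 < subEdge s d := by omega
      have hloca : loc d (setLoc d p a (loc d p a - 1)) a = loc d p a - 1 := loc_setLoc_self p hprev
      have hlocb : loc d (setLoc d p a (loc d p a - 1)) b = loc d p b := loc_setLoc_of_ne p _ hab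
      simp only [h0, if_false, receive, nbr_down_eq_setLoc p a ha h0, Option.bind_some]
      change ((g _).send (a, true)).bind _ = _
      rw [hup, Option.bind_some,
        h.bot (setLoc d p a (loc d p a - 1)) k (by omega) (by omega) hk (by omega),
        setLoc_setLoc p a hprev hk]

/-- `c` is the sum for `C(i,j)` from `lo` to `hi`, unless this range is empty. -/
def Holds (i j : Fin n) (lo hi : ℕ) (c : Option (Term n)) : Prop :=
  lo < hi → ∃ u, c = some u ∧ PartialSum i j lo hi u

lemma Holds.succ {i j k : Fin n} {lo : ℕ} {c : Option (Term n)} (h : Holds i j lo k c)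
    (hlo : lo ≤ k) :
    Holds i j lo (k + 1) (if lo = k then some (.times (.entryA i k) (.entryB k j)) else
      Option.map₂ .plus c (some (.times (.entryA i k) (.entryB k j)))) := by
  rintro -
  split_ifs with heq
  · subst heq
    exact ⟨_, rfl, .single k⟩
  · obtain ⟨u, rfl, hu⟩ := h (hlo.lt_of_ne heq)
    exact ⟨_, rfl, hu.plus (.single k)⟩

/-- The roles of the registers in the multiplication of matrices in a layer: the conveyors for `A`
and `B`, the last product, and the sum. -/
inductive LayerReg
  | aTop | aBot | bTop | bBot | prod | acc
  deriving DecidableEq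

/-- What is to be computed in the layers of the subcubes: every processor `p` that is `active` has
the partial sum of the entry `(row p, col p)` from `lo p` to `base p`, and has to add the next
`len p` summands. -/
structure LayerTask (n s : ℕ) where
  active : Proc s → Prop
  row : Proc s → Fin n
  col : Proc s → Fin n
  lo : Proc s → ℕ
  base : Proc s → ℕ
  len : Proc s → ℕ

namespace LayerTask

/-- In the state `σ` the task `W` can be carried out: the operands are in the same layer, those from
`A` in the row of the axis `1`, and those from `B` in the row of the axis `0`. -/
structure Ready (W : LayerTask n s) (d : ℕ) (ρ : LayerReg ↪ Fin R) (σ : TermRegs n s R) : Prop where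
  len_le : ∀ p, W.active p → W.len p ≤ subEdge s d
  loc_zero_lt : ∀ p, W.active p → loc d p 0 < subEdge s d
  loc_one_lt : ∀ p, W.active p → loc d p 1 < subEdge s d
  lo_le : ∀ p, W.active p → W.lo p ≤ W.base p
  add_len_le : ∀ p, W.active p → W.base p + W.len p ≤ n
  entryA : ∀ p, W.active p → ∀ (k : Fin n) l, l < W.len p → (k : ℕ) = W.base p + l →
    σ (setLoc d p 1 l) (ρ .aTop) = some (.entryA (W.row p) k)
  entryB : ∀ p, W.active p → ∀ (k : Fin n) l, l < W.len p → (k : ℕ) = W.base p + l →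
    σ (setLoc d p 0 l) (ρ .bTop) = some (.entryB k (W.col p))
  acc : ∀ p, W.active p → Holds (W.row p) (W.col p) (W.lo p) (W.base p) (σ p (ρ .acc))
  inSubcube : ∀ p, W.active p → ∀ k : Fin n, W.lo p ≤ k → (k : ℕ) < W.base p + W.len p →
    InSubcube d p (W.row p) k (W.col p)

/-- The number of the summand that reaches `p` in the round `t`, according to the conveyors. -/
def turn (d t : ℕ) (p : Proc s) : ℕ := t - loc d p 0 - loc d p 1

/-- The processor `p` has a summand to deal with in the round `t`. -/
def Busy (W : LayerTask n s) (d t : ℕ) (p : Proc s) : Prop :=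
  W.active p ∧ loc d p 0 + loc d p 1 ≤ t ∧ turn d t p < W.len p

open Classical in
/-- The first step of the round `t`: the conveyors move, and the products are formed. -/
noncomputable def multiplyStep (W : LayerTask n s) (d : ℕ) (ρ : LayerReg ↪ Fin R) (t : ℕ)
    (p : Proc s) : Action R where
  send e := if e.1 = 1 then (if e.2 then some (ρ .aBot) else some (ρ .aTop))
    else (if e.2 then some (ρ .bBot) else some (ρ .bTop))
  load r :=
    if r = ρ .aTop then (if loc d p 0 ≤ t then .inbox (1, true) else .own (ρ .aTop))
    else if r = ρ .aBot then (if loc d p 1 = 0 then .own (ρ .aTop) else .inbox (1, false))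
    else if r = ρ .bTop then (if loc d p 1 ≤ t then .inbox (0, true) else .own (ρ .bTop))
    else if r = ρ .bBot then (if loc d p 0 = 0 then .own (ρ .bTop) else .inbox (0, false))
    else .own r
  op := if W.Busy d t p then some ⟨.times, ρ .aBot, ρ .bBot, ρ .prod⟩ else none

open Classical in
/-- The second step of the round `t`: the products are added to the sums, or start them. -/
noncomputable def accumulateStep (W : LayerTask n s) (d : ℕ) (ρ : LayerReg ↪ Fin R) (t : ℕ)
    (p : Proc s) : Action R where
  send _ := none
  load r :=
    if r = ρ .acc ∧ W.Busy d t p ∧ W.lo p = W.base p + turn d t p then .own (ρ .prod) else .own r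
  op := if W.Busy d t p ∧ W.lo p ≠ W.base p + turn d t p then
    some ⟨.plus, ρ .acc, ρ .prod, ρ .acc⟩ else none

/-- The invariant of the multiplication in the layers, after `t` rounds. -/
structure Inv (W : LayerTask n s) (d : ℕ) (ρ : LayerReg ↪ Fin R) (σ : TermRegs n s R) (t : ℕ)
    (τ : TermRegs n s R) : Prop where
  conveyorA : Conveyor d 1 0 (ρ .aTop) (ρ .aBot) (fun p => σ p (ρ .aTop)) t τ
  conveyorB : Conveyor d 0 1 (ρ .bTop) (ρ .bBot) (fun p => σ p (ρ .bTop)) t τ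
  acc : ∀ p, W.active p →
    Holds (W.row p) (W.col p) (W.lo p) (W.base p + min (W.len p) (turn d t p)) (τ p (ρ .acc))
  other : ∀ p r, (∀ x, r ≠ ρ x) → τ p r = σ p r

variable {W : LayerTask n s} {ρ : LayerReg ↪ Fin R} {σ τ : TermRegs n s R} {t : ℕ} {p : Proc s}

lemma Ready.inv_zero (h : W.Ready d ρ σ) : W.Inv d ρ σ 0 σ where
  conveyorA := .zero σ
  conveyorB := .zero σ
  acc p hp := by simpa [turn] using h.acc p hp
  other _ _ _ := rfl

lemma Inv.conveyorA_succ (hτ : W.Inv d ρ σ t τ) : Conveyor d 1 0 (ρ .aTop) (ρ .aBot)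
    (fun p => σ p (ρ .aTop)) (t + 1) (loadRegs (W.multiplyStep d ρ t) τ) :=
  hτ.conveyorA.succ (by decide) (fun p => by simp [multiplyStep])
    (fun p => by simp [multiplyStep]) (fun p => by simp [multiplyStep])
    (fun p => by simp [multiplyStep])

lemma Inv.conveyorB_succ (hτ : W.Inv d ρ σ t τ) : Conveyor d 0 1 (ρ .bTop) (ρ .bBot)
    (fun p => σ p (ρ .bTop)) (t + 1) (loadRegs (W.multiplyStep d ρ t) τ) :=
  hτ.conveyorB.succ (by decide) (fun p => by simp [multiplyStep])
    (fun p => by simp [multiplyStep]) (fun p => by simp [multiplyStep])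
    (fun p => by simp [multiplyStep])

lemma exists_operands (hσ : W.Ready d ρ σ) (hτ : W.Inv d ρ σ t τ) (hp : W.Busy d t p) :
    ∃ k : Fin n, (k : ℕ) = W.base p + turn d t p ∧
      loadRegs (W.multiplyStep d ρ t) τ p (ρ .aBot) = some (.entryA (W.row p) k) ∧
      loadRegs (W.multiplyStep d ρ t) τ p (ρ .bBot) = some (.entryB k (W.col p)) := by
  obtain ⟨hact, hstart, hturn⟩ := hp
  have hlen := hσ.len_le p hact
  have h0 := hσ.loc_zero_lt p hact
  have h1 := hσ.loc_one_lt p hact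
  have hn := hσ.add_len_le p hact
  have ht : 1 + loc d p 0 + loc d p 1 + turn d t p = t + 1 := by unfold turn; omega
  refine ⟨⟨W.base p + turn d t p, by omega⟩, rfl, ?_, ?_⟩
  · rw [hτ.conveyorA_succ.bot p _ h1 h0 (hturn.trans_le hlen) ht]
    exact hσ.entryA p hact _ _ hturn rfl
  · rw [hτ.conveyorB_succ.bot p _ h0 h1 (hturn.trans_le hlen) (by omega)]
    exact hσ.entryB p hact _ _ hturn rfl

lemma stepAllowed_multiplyStep (hσ : W.Ready d ρ σ) (hτ : W.Inv d ρ σ t τ) :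
    StepAllowed d (W.multiplyStep d ρ t) τ := by
  intro p I u v hI hu hv
  simp only [multiplyStep, Option.ite_none_right_eq_some, Option.some.injEq] at hI
  obtain ⟨hp, rfl⟩ := hI
  obtain ⟨k, hk, ha, hb⟩ := exists_operands hσ hτ hp
  obtain rfl : u = _ := Option.some.inj (hu.symm.trans ha)
  obtain rfl : v = _ := Option.some.inj (hv.symm.trans hb)
  have hlo := hσ.lo_le p hp.1
  have hturn := hp.2.2
  exact ⟨fun _ => ⟨_, k, _, rfl, rfl, hσ.inSubcube p hp.1 k (by omega) (by omega)⟩, nofun⟩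

lemma multiplyStep_of_ne_prod {r : Fin R} (hr : r ≠ ρ .prod) :
    termStep (W.multiplyStep d ρ t) τ p r = loadRegs (W.multiplyStep d ρ t) τ p r := by
  by_cases hp : W.Busy d t p <;> simp [execStep, multiplyStep, hp, hr]

lemma multiplyStep_acc : termStep (W.multiplyStep d ρ t) τ p (ρ .acc) = τ p (ρ .acc) := by
  rw [multiplyStep_of_ne_prod (by simp)]
  simp [loadRegs, multiplyStep]

lemma multiplyStep_other {r : Fin R} (hr : ∀ x, r ≠ ρ x) :
    termStep (W.multiplyStep d ρ t) τ p r = τ p r := by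
  rw [multiplyStep_of_ne_prod (hr _)]
  simp [loadRegs, multiplyStep, hr]

lemma exists_multiplyStep_prod (hσ : W.Ready d ρ σ) (hτ : W.Inv d ρ σ t τ) (hp : W.Busy d t p) :
    ∃ k : Fin n, (k : ℕ) = W.base p + turn d t p ∧
      termStep (W.multiplyStep d ρ t) τ p (ρ .prod) =
        some (.times (.entryA (W.row p) k) (.entryB k (W.col p))) := by
  obtain ⟨k, hk, ha, hb⟩ := exists_operands hσ hτ hp
  have hstep : termStep (W.multiplyStep d ρ t) τ p (ρ .prod) =
      Option.map₂ Term.times (loadRegs (W.multiplyStep d ρ t) τ p (ρ .aBot))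
        (loadRegs (W.multiplyStep d ρ t) τ p (ρ .bBot)) := by
    simp only [execStep, multiplyStep, hp, if_true, update_self]
    rfl
  exact ⟨k, hk, by rw [hstep, ha, hb]; rfl⟩

lemma accumulateStep_of_ne_acc {r : Fin R} (hr : r ≠ ρ .acc) :
    termStep (W.accumulateStep d ρ t) τ p r = τ p r := by
  by_cases hp : W.Busy d t p ∧ W.lo p ≠ W.base p + turn d t p <;>
    simp [execStep, loadRegs, accumulateStep, hp, hr]

open Classical in
lemma accumulateStep_acc : termStep (W.accumulateStep d ρ t) τ p (ρ .acc) =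
    if W.Busy d t p then if W.lo p = W.base p + turn d t p then τ p (ρ .prod) else
      Option.map₂ .plus (τ p (ρ .acc)) (τ p (ρ .prod)) else τ p (ρ .acc) := by
  by_cases hp : W.Busy d t p <;> by_cases hlo : W.lo p = W.base p + turn d t p <;>
    simp [execStep, loadRegs, accumulateStep, hp, hlo, OpKind.fn]

lemma Inv.acc_of_busy (hτ : W.Inv d ρ σ t τ) (hp : W.Busy d t p) :
    Holds (W.row p) (W.col p) (W.lo p) (W.base p + turn d t p) (τ p (ρ .acc)) := by
  simpa only [min_eq_right hp.2.2.le] using hτ.acc p hp.1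

lemma stepAllowed_accumulateStep (hσ : W.Ready d ρ σ) (hτ : W.Inv d ρ σ t τ) :
    StepAllowed d (W.accumulateStep d ρ t) (termStep (W.multiplyStep d ρ t) τ) := by
  intro p I u v hI hu hv
  simp only [accumulateStep, Option.ite_none_right_eq_some, Option.some.injEq] at hI
  obtain ⟨⟨hp, hne⟩, rfl⟩ := hI
  obtain ⟨k, hk, hprod⟩ := exists_multiplyStep_prod hσ hτ hp
  have hlo := hσ.lo_le p hp.1
  obtain ⟨w, hw, hsum⟩ := hτ.acc_of_busy hp (by omega)
  have hu' : u = w := by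
    simpa [loadRegs, accumulateStep, hne, multiplyStep_acc, hw, eq_comm] using hu
  have hv' : v = .times (.entryA (W.row p) k) (.entryB k (W.col p)) := by
    simpa [loadRegs, accumulateStep, hprod, eq_comm] using hv
  have hturn := hp.2.2
  exact ⟨nofun, fun _ => ⟨_, _, W.lo p, k, k + 1, by rwa [hu', hk], hv' ▸ .single k,
    .inl fun k' hk' => hσ.inSubcube p hp.1 k' hk'.1 (by omega)⟩⟩

lemma holds_acc_succ (hσ : W.Ready d ρ σ) (hτ : W.Inv d ρ σ t τ) (hp : W.active p) :
    Holds (W.row p) (W.col p) (W.lo p) (W.base p + min (W.len p) (turn d (t + 1) p))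
      (termStep (W.accumulateStep d ρ t) (termStep (W.multiplyStep d ρ t) τ) p (ρ .acc)) := by
  by_cases hbusy : W.Busy d t p
  · obtain ⟨k, hk, hprod⟩ := exists_multiplyStep_prod hσ hτ hbusy
    have hlo := hσ.lo_le p hp
    have hturn := hbusy.2
    have hacc : Holds (W.row p) (W.col p) (W.lo p) k (τ p (ρ .acc)) := hk ▸ hτ.acc_of_busy hbusy
    have hnext : W.base p + min (W.len p) (turn d (t + 1) p) = k + 1 := by
      unfold turn at *
      omega
    rw [accumulateStep_acc, multiplyStep_acc, if_pos hbusy, hprod, hnext, ← hk]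
    exact hacc.succ (by omega)
  · have hsame : min (W.len p) (turn d (t + 1) p) = min (W.len p) (turn d t p) := by
      simp only [Busy, hp, true_and, not_and, not_lt] at hbusy
      unfold turn at *
      omega
    rw [accumulateStep_acc, multiplyStep_acc, if_neg hbusy, hsame]
    exact hτ.acc p hp

lemma Inv.succ (hσ : W.Ready d ρ σ) (hτ : W.Inv d ρ σ t τ) : W.Inv d ρ σ (t + 1)
    (termStep (W.accumulateStep d ρ t) (termStep (W.multiplyStep d ρ t) τ)) := by
  have hload {p r} (hacc : r ≠ ρ .acc) (hprod : r ≠ ρ .prod) :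
      termStep (W.accumulateStep d ρ t) (termStep (W.multiplyStep d ρ t) τ) p r =
        loadRegs (W.multiplyStep d ρ t) τ p r := by
    rw [accumulateStep_of_ne_acc hacc, multiplyStep_of_ne_prod hprod]
  refine ⟨hτ.conveyorA_succ.congr (fun p => hload ?_ ?_) (fun p => hload ?_ ?_),
    hτ.conveyorB_succ.congr (fun p => hload ?_ ?_) (fun p => hload ?_ ?_),
    fun p => holds_acc_succ hσ hτ, fun p r hr => ?_⟩
  any_goals simp
  rw [accumulateStep_of_ne_acc (hr _), multiplyStep_other hr, hτ.other p r hr]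

end LayerTask

lemma reach_layer_product (W : LayerTask n s) (ρ : LayerReg ↪ Fin R) {σ : TermRegs n s R}
    (hσ : W.Ready d ρ σ) :
    Reach d (fun τ => (∀ p, W.active p →
        Holds (W.row p) (W.col p) (W.lo p) (W.base p + W.len p) (τ p (ρ .acc))) ∧
      ∀ p r, (∀ x, r ≠ ρ x) → τ p r = σ p r) (3 * subEdge s d * 2) σ := by
  have hloop : Reach d (W.Inv d ρ σ (3 * subEdge s d)) (3 * subEdge s d * 2) σ :=
    .loop _ (fun t _ τ hτ => .step _ (W.stepAllowed_multiplyStep hσ hτ) <|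
      .step _ (W.stepAllowed_accumulateStep hσ hτ) <| .done (hτ.succ hσ)) hσ.inv_zero
  refine hloop.weaken le_rfl fun τ hτ => ⟨fun p hp => ?_, hτ.other⟩
  have hfinished : min (W.len p) (LayerTask.turn d (3 * subEdge s d) p) = W.len p := by
    have hlen := hσ.len_le p hp
    have h0 := hσ.loc_zero_lt p hp
    have h1 := hσ.loc_one_lt p hp
    unfold LayerTask.turn
    omega
  exact hfinished ▸ hτ.acc p hp

end Layer

/-! ### The homes of the entries of a block -/

section Homes

variable {s n d : ℕ}

/-- The base in which the layers of a subcube are numbered by two digits. -/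
def layerBase (s d : ℕ) : ℕ := Nat.sqrt (subEdge s d)

/-- The side of the largest square matrices that are stored in a subcube with one entry per
processor; the blocks of the last level are cut into chunks of this side. -/
def chunk (s d : ℕ) : ℕ := subEdge s d * layerBase s d

/-- `p` is a home of the entry `(i, k)` of a matrix. The coordinates of its subcube on the axes `β`
and `γ` are the numbers of the row block and of the column block; the numbers of the row and of the
column within the chunk `(c, c')` of this block have two digits each, which are the coordinates of
`p` within the subcube if the two leading digits are merged to one number. -/
structure IsHome (d : ℕ) (β γ : Fin 3) (c c' : ℕ) (i k : Fin n) (p : Proc s) : Prop where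
  loc_lt : ∀ a, loc d p a < subEdge s d
  layer_lt : loc d p 2 < layerBase s d * layerBase s d
  row_part : part n d i = blk d p β
  col_part : part n d k = blk d p γ
  row_eq : (i : ℕ) = blockStart (2 ^ d) n (blk d p β) +
    (c * chunk s d + (loc d p 2 / layerBase s d * subEdge s d + loc d p 0))
  col_eq : (k : ℕ) = blockStart (2 ^ d) n (blk d p γ) +
    (c' * chunk s d + (loc d p 2 % layerBase s d * subEdge s d + loc d p 1))

variable {β γ φ : Fin 3} {c c' : ℕ} {i i' k k' : Fin n} {p q : Proc s}

lemma IsHome.congr (h : IsHome d β γ c c' i k p) (hβ : blk d q β = blk d p β)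
    (hγ : blk d q γ = blk d p γ) (hloc : ∀ a, loc d q a = loc d p a) :
    IsHome d β γ c c' i k q where
  loc_lt a := hloc a ▸ h.loc_lt a
  layer_lt := hloc 2 ▸ h.layer_lt
  row_part := hβ ▸ h.row_part
  col_part := hγ ▸ h.col_part
  row_eq := by rw [hβ, hloc, hloc, h.row_eq]
  col_eq := by rw [hγ, hloc, hloc, h.col_eq]

lemma IsHome.place (h : IsHome d β γ c c' i k p) (hβφ : β ≠ φ) (hγφ : γ ≠ φ) {K : ℕ}
    (hK : K < 2 ^ d) : IsHome d β γ c c' i k (place d p φ K (loc d p φ)) := by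
  refine h.congr (blk_place_of_ne p _ _ hβφ) (blk_place_of_ne p _ _ hγφ) fun a => ?_
  obtain rfl | ha := eq_or_ne a φ
  · exact loc_place_self p hK (h.loc_lt a)
  · exact loc_place_of_ne p _ _ ha

lemma IsHome.entry_unique (h : IsHome d β γ c c' i k p) (h' : IsHome d β γ c c' i' k' p) :
    i = i' ∧ k = k' :=
  ⟨Fin.ext (h.row_eq.trans h'.row_eq.symm), Fin.ext (h.col_eq.trans h'.col_eq.symm)⟩

lemma digits_unique {b x x' y y' : ℕ} (hy : y < b) (hy' : y' < b) (h : x * b + y = x' * b + y') :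
    x = x' ∧ y = y' := by
  have hb : 0 < b := by omega
  have hdiv := congrArg (· / b) h
  have hmod := congrArg (· % b) h
  simp only [Nat.mul_comm _ b, Nat.mul_add_div hb, Nat.mul_add_mod, Nat.div_eq_of_lt hy,
    Nat.div_eq_of_lt hy', Nat.mod_eq_of_lt hy, Nat.mod_eq_of_lt hy', add_zero] at hdiv hmod
  exact ⟨hdiv, hmod⟩

lemma IsHome.proc_unique (hcov : ∀ a, a = β ∨ a = γ ∨ a = φ) (hp : IsHome d β γ c c' i k p)
    (hq : IsHome d β γ c c' i k q) (hφ : blk d p φ = blk d q φ) : p = q := by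
  have hβ : blk d p β = blk d q β := hp.row_part.symm.trans hq.row_part
  have hγ : blk d p γ = blk d q γ := hp.col_part.symm.trans hq.col_part
  have hrow := hp.row_eq.symm.trans hq.row_eq
  have hcol := hp.col_eq.symm.trans hq.col_eq
  rw [hβ, Nat.add_left_cancel_iff, Nat.add_left_cancel_iff] at hrow
  rw [hγ, Nat.add_left_cancel_iff, Nat.add_left_cancel_iff] at hcol
  obtain ⟨hdiv, h0⟩ := digits_unique (hp.loc_lt 0) (hq.loc_lt 0) hrow
  obtain ⟨hmod, h1⟩ := digits_unique (hp.loc_lt 1) (hq.loc_lt 1) hcol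
  refine proc_ext (d := d) (fun a => ?_) (Fin.forall_fin_succ.2 ⟨h0, Fin.forall_fin_two.2 ⟨h1, ?_⟩⟩)
  · rcases hcov a with rfl | rfl | rfl <;> assumption
  · exact (Nat.div_add_mod (loc d p 2) (layerBase s d)).symm.trans
      (hdiv ▸ hmod ▸ Nat.div_add_mod (loc d q 2) (layerBase s d))

lemma exists_proc {B X : Fin 3 → ℕ} (hB : ∀ a, B a < 2 ^ d) (hX : ∀ a, X a < subEdge s d) :
    ∃ p : Proc s, (∀ a, blk d p a = B a) ∧ ∀ a, loc d p a = X a := by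
  let p : Proc s := fun a => ⟨_, blockStart_add_lt (hB a) (hX a)⟩
  have hp (a : Fin 3) : p = Mesh.place d p a (B a) (X a) := by
    rw [Mesh.place, dif_pos (blockStart_add_lt (hB a) (hX a))]
    exact (update_eq_self a p).symm
  refine ⟨p, fun a => ?_, fun a => ?_⟩
  · rw [hp a]
    exact blk_place_self p (hB a) (hX a)
  · rw [hp a]
    exact loc_place_self p (hB a) (hX a)

lemma exists_digits {N : ℕ} (hs : 2 ^ d ≤ s) (hN : n / 2 ^ d + 1 ≤ N * chunk s d) (i : Fin n) :
    ∃ c < N, ∃ b < layerBase s d, ∃ x < subEdge s d,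
      (i : ℕ) = blockStart (2 ^ d) n (part n d i) + (c * chunk s d + (b * subEdge s d + x)) := by
  have hedge : 0 < subEdge s d := Nat.div_pos hs (by positivity)
  have hchunk : 0 < chunk s d := Nat.mul_pos hedge (Nat.sqrt_pos.2 hedge)
  obtain ⟨hlo, hhi⟩ := (part_eq_iff (d := d) (K := part n d i) i.pos).1 rfl
  have hlen := blockStart_add_le (D := 2 ^ d) (N := n) (K := part n d i) (by positivity) 1
  rw [one_mul] at hlen
  obtain ⟨u, hu⟩ := Nat.exists_eq_add_of_le hlo
  refine ⟨u / chunk s d, ?_, u % chunk s d / subEdge s d, ?_, u % chunk s d % subEdge s d,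
    Nat.mod_lt _ hedge, ?_⟩
  · rw [Nat.div_lt_iff_lt_mul hchunk]
    omega
  · rw [Nat.div_lt_iff_lt_mul hedge, mul_comm]
    exact Nat.mod_lt _ hchunk
  · rwa [Nat.div_add_mod', Nat.div_add_mod']

lemma two_digits_lt {b x y : ℕ} (hx : x < b) (hy : y < b) : x * b + y < b * b := by
  nlinarith

lemma isHome_of_digits {b b' : ℕ} (hb : b < layerBase s d) (hb' : b' < layerBase s d)
    (h0 : loc d p 0 < subEdge s d) (h1 : loc d p 1 < subEdge s d)
    (h2 : loc d p 2 = b * layerBase s d + b')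
    (hβ : part n d i = blk d p β) (hγ : part n d k = blk d p γ)
    (hi : (i : ℕ) = blockStart (2 ^ d) n (blk d p β) +
      (c * chunk s d + (b * subEdge s d + loc d p 0)))
    (hk : (k : ℕ) = blockStart (2 ^ d) n (blk d p γ) +
      (c' * chunk s d + (b' * subEdge s d + loc d p 1))) :
    IsHome d β γ c c' i k p := by
  have hlayer : loc d p 2 < layerBase s d * layerBase s d := h2 ▸ two_digits_lt hb hb'
  refine ⟨Fin.forall_fin_succ.2 ⟨h0, Fin.forall_fin_two.2 ⟨h1, hlayer.trans_le (Nat.sqrt_le _)⟩⟩,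
    hlayer, hβ, hγ, ?_, ?_⟩
  · rwa [h2, mul_comm b, Nat.mul_add_div (by omega), Nat.div_eq_of_lt hb', add_zero]
  · rwa [h2, mul_comm b, Nat.mul_add_mod, Nat.mod_eq_of_lt hb']

lemma exists_isHome (hβγ : β ≠ γ) (hβφ : β ≠ φ) (hγφ : γ ≠ φ) {N : ℕ} (hs : 2 ^ d ≤ s)
    (hN : n / 2 ^ d + 1 ≤ N * chunk s d) (i k : Fin n) :
    ∃ c < N, ∃ c' < N, ∃ p : Proc s, IsHome d β γ c c' i k p ∧ blk d p φ = 0 := by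
  obtain ⟨c, hc, b, hb, x, hx, hi⟩ := exists_digits hs hN i
  obtain ⟨c', hc', b', hb', x', hx', hk⟩ := exists_digits hs hN k
  have hlayer := (two_digits_lt hb hb').trans_le (Nat.sqrt_le _)
  obtain ⟨p, hblk, hloc⟩ := exists_proc
    (B := fun a => if a = β then part n d i else if a = γ then part n d k else 0)
    (X := ![x, x', b * layerBase s d + b'])
    (fun a => by split_ifs <;> first | exact part_lt (Fin.isLt _) | positivity)
    (Fin.forall_fin_succ.2 ⟨hx, Fin.forall_fin_two.2 ⟨hx', hlayer⟩⟩)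
  have h0 : loc d p 0 = x := hloc 0
  have h1 : loc d p 1 = x' := hloc 1
  have hβ : blk d p β = part n d i := by rw [hblk, if_pos rfl]
  have hγ : blk d p γ = part n d k := by rw [hblk, if_neg hβγ.symm, if_pos rfl]
  exact ⟨c, hc, c', hc', p, isHome_of_digits hb hb' (h0 ▸ hx) (h1 ▸ hx') (hloc 2) hβ.symm hγ.symm
    (by rw [hβ, h0, ← hi]) (by rw [hγ, h1, ← hk]), by rw [hblk, if_neg hβφ.symm, if_neg hγφ.symm]⟩

lemma exists_perm_of_layout (hcov : ∀ a, a = β ∨ a = γ ∨ a = φ) (c c' : ℕ) (M : Layout n s) :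
    ∃ π : Equiv.Perm (Proc s), ∀ p i k, IsHome d β γ c c' i k p → blk d p φ = 0 →
      π p = M (i, k) := by
  classical
  let IsHomeIn (p : Proc s) (e : Fin n × Fin n) : Prop :=
    IsHome d β γ c c' e.1 e.2 p ∧ blk d p φ = 0
  let f (p : Proc s) : Proc s := if h : ∃ e, IsHomeIn p e then M h.choose else p
  have hf {p : Proc s} {e : Fin n × Fin n} (he : IsHomeIn p e) : f p = M e := by
    have h : ∃ e, IsHomeIn p e := ⟨e, he⟩
    have hunique := h.choose_spec.1.entry_unique he.1
    rw [show f p = M h.choose from dif_pos h, Prod.ext hunique.1 hunique.2]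
  have hinj : Set.InjOn f (univ.filter fun p => ∃ e, IsHomeIn p e : Finset (Proc s)) := by
    intro p hp q hq hpq
    obtain ⟨e, hp⟩ := (mem_filter.1 hp).2
    obtain ⟨e', hq⟩ := (mem_filter.1 hq).2
    rw [hf hp, hf hq, M.injective.eq_iff] at hpq
    subst hpq
    exact hp.1.proc_unique hcov hq.1 (hp.2.trans hq.2.symm)
  obtain ⟨g, hg⟩ := exists_equiv_extend_of_card_eq (t := (univ : Finset (Proc s))) card_univ.symm
    (subset_univ _) hinj
  refine ⟨g.trans (Equiv.subtypeUnivEquiv mem_univ), fun p i k hp hφ => ?_⟩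
  have he : IsHomeIn p (i, k) := ⟨hp, hφ⟩
  exact (hg p (mem_filter.2 ⟨mem_univ p, _, he⟩)).trans (hf he)

lemma reach_distribute {R : ℕ} (hcov : ∀ a, a = β ∨ a = γ ∨ a = φ) (hβφ : β ≠ φ) (hγφ : γ ≠ φ)
    (c c' : ℕ) (M : Layout n s) (e : Fin n → Fin n → Term n) {src dst mid x y tmp : Fin R}
    (hr : [src, mid, x, y, tmp, dst].Nodup) (σ : TermRegs n s R)
    (hσ : ∀ i k, σ (M (i, k)) src = some (e i k)) :
    Reach d (fun τ => (∀ i k p, IsHome d β γ c c' i k p → τ p dst = some (e i k)) ∧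
      ∀ p r, r ∉ [dst, mid, x, y, tmp] → τ p r = σ p r) (12 * s + 12) σ := by
  obtain ⟨π, hπ⟩ := exists_perm_of_layout (d := d) hcov c c' M
  have hpermute := reach_permute (d := d) π (hr.sublist (by simp) : [src, mid, x, y, tmp].Nodup)
    (fun _ => True) σ
  simp only [List.nodup_cons, List.mem_cons, List.not_mem_nil, or_false, not_or] at hr
  obtain ⟨-, ⟨-, -, hmt, hmd⟩, -, -, htd, -⟩ := hr
  refine (hpermute.bind fun σ₁ h₁ =>
    (reach_fetch φ hmd hmt (Ne.symm htd) (M := fun p => loc d p φ < subEdge s d)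
      (G := fun p => place d p φ 0 (loc d p φ)) s
      (fun p _ => ⟨fun b hb => place_of_ne p _ _ hb, by omega, by omega⟩) σ₁).weaken le_rfl
      fun σ₂ h₂ => ?_).weaken (by omega) fun _ h => h
  refine ⟨fun i k p hp => ?_, fun p r hr => ?_⟩
  · have h0 : 0 < 2 ^ d := by positivity
    rw [h₂.fetched p (hp.loc_lt φ), h₁.fetched _ trivial,
      hπ _ i k (hp.place hβφ hγφ h0) (blk_place_self p h0 (hp.loc_lt φ)), hσ]
  · simp only [List.mem_cons, List.not_mem_nil, or_false, not_or] at hr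
    rw [h₂.other p r hr.1 (by simp [hr]), h₁.other p r (by simp [hr]) (by simp [hr])]

end Homes

/-! ### The multiplication of chunks -/

/- The registers of a processor are used as follows: 0, 1 and 2 for the given entries of `A` and `B`
and the results; 3 and 4 for the entries of `A` and `B` at their homes; 5 to 8 for the entries that
pass by in the multiplication in a layer; 9 for a product; 10 for the partial sum; 11 to 13 for
routing. The axes 0, 1 and 2 of the mesh belong to the ranges of `i`, `k` and `j`. -/
section ChunkProduct

variable {s n d : ℕ} {ci ck cj q m : ℕ} {σ τ : TermRegs n s 14} {p : Proc s} {i j k : Fin n}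

/-- The end of the first `m` indices in the summation range of the block of `p`. -/
def sumEnd (n d : ℕ) (p : Proc s) (m : ℕ) : ℕ :=
  min (blockStart (2 ^ d) n (blk d p 1) + m) (blockStart (2 ^ d) n (blk d p 1 + 1))

lemma blockStart_le_sumEnd (p : Proc s) (m : ℕ) :
    blockStart (2 ^ d) n (blk d p 1) ≤ sumEnd n d p m :=
  le_min (Nat.le_add_right _ _) (blockStart_mono (Nat.le_succ _))

lemma sumEnd_le (p : Proc s) (m : ℕ) : sumEnd n d p m ≤ blockStart (2 ^ d) n (blk d p 1 + 1) :=
  min_le_right _ _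

lemma sumEnd_mono (p : Proc s) {m m' : ℕ} (h : m ≤ m') : sumEnd n d p m ≤ sumEnd n d p m' :=
  min_le_min_right _ (by omega)

lemma blockStart_blk_succ_le (p : Proc s) (a : Fin 3) :
    blockStart (2 ^ d) n (blk d p a + 1) ≤ n :=
  (blockStart_mono (blk_lt p a)).trans_eq (blockStart_self (by positivity))

/-- The homes of `C` hold the sums of the first `m` summands from the summation ranges of their
blocks. -/
def Accumulated (d ci cj m : ℕ) (σ : TermRegs n s 14) : Prop :=
  ∀ i j p, IsHome d 0 2 ci cj i j p →
    Holds i j (blockStart (2 ^ d) n (blk d p 1)) (sumEnd n d p m) (σ p 10)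

/-- The entries of the chunks of `A` and `B` are at their homes. -/
structure Distributed (d ci ck cj : ℕ) (σ : TermRegs n s 14) : Prop where
  entryA : ∀ i k p, IsHome d 0 1 ci ck i k p → σ p 3 = some (.entryA i k)
  entryB : ∀ k j p, IsHome d 1 2 ck cj k j p → σ p 4 = some (.entryB k j)

lemma IsHome.operandA (h : IsHome d 0 2 ci cj i j p) (hq : q < layerBase s d) {x : ℕ}
    (hx : x < subEdge s d) (hpart : part n d k = blk d p 1)
    (hk : (k : ℕ) = blockStart (2 ^ d) n (blk d p 1) + (ck * chunk s d + (q * subEdge s d + x))) :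
    IsHome d 0 1 ci ck i k
      (setLoc d (setLoc d p 1 x) 2 (loc d p 2 / layerBase s d * layerBase s d + q)) := by
  have hdigit := (Nat.div_lt_iff_lt_mul (by omega)).2 h.layer_lt
  have hlayer := (two_digits_lt hdigit hq).trans_le (Nat.sqrt_le _)
  refine isHome_of_digits hdigit hq ?_ ?_ (loc_setLoc_self _ hlayer) ?_ ?_ ?_ ?_ <;>
    simp only [blk_setLoc _ _ _ hlayer, blk_setLoc _ _ _ hx, ne_eq, Fin.reduceEq, not_false_eq_true,
      loc_setLoc_of_ne, loc_setLoc_self _ hx]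
  exacts [h.loc_lt 0, hx, h.row_part, hpart, h.row_eq, hk]

lemma IsHome.operandB (h : IsHome d 0 2 ci cj i j p) (hq : q < layerBase s d) {x : ℕ}
    (hx : x < subEdge s d) (hpart : part n d k = blk d p 1)
    (hk : (k : ℕ) = blockStart (2 ^ d) n (blk d p 1) + (ck * chunk s d + (q * subEdge s d + x))) :
    IsHome d 1 2 ck cj k j
      (setLoc d (setLoc d p 0 x) 2 (q * layerBase s d + loc d p 2 % layerBase s d)) := by
  have hdigit : loc d p 2 % layerBase s d < layerBase s d := Nat.mod_lt _ (by omega)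
  have hlayer := (two_digits_lt hq hdigit).trans_le (Nat.sqrt_le _)
  refine isHome_of_digits hq hdigit ?_ ?_ (loc_setLoc_self _ hlayer) ?_ ?_ ?_ ?_ <;>
    simp only [blk_setLoc _ _ _ hlayer, blk_setLoc _ _ _ hx, ne_eq, Fin.reduceEq, not_false_eq_true,
      loc_setLoc_of_ne, loc_setLoc_self _ hx]
  exacts [hx, h.loc_lt 1, hpart, h.col_part, hk, h.col_eq]

/-- The registers for the multiplication in a layer. -/
def layerRegs : LayerReg ↪ Fin 14 where
  toFun
    | .aTop => 5
    | .aBot => 6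
    | .bTop => 7
    | .bBot => 8
    | .prod => 9
    | .acc => 10
  inj' x y := by cases x <;> cases y <;> simp

/-- In a round of the multiplication of chunks, the summands with the numbers from `m` to
`m + subEdge s d` are added, where the entry with its home at `p` is given by `e p`. -/
def roundTask (d ci cj m : ℕ) (e : Proc s → Fin n × Fin n) : LayerTask n s where
  active p := IsHome d 0 2 ci cj (e p).1 (e p).2 p
  row p := (e p).1
  col p := (e p).2
  lo p := blockStart (2 ^ d) n (blk d p 1)
  base p := sumEnd n d p m
  len p := sumEnd n d p (m + subEdge s d) - sumEnd n d p m

lemma lt_of_lt_len {x : ℕ} (hx : x < sumEnd n d p (m + subEdge s d) - sumEnd n d p m)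
    (hk : (k : ℕ) = sumEnd n d p m + x) :
    x < subEdge s d ∧ part n d k = blk d p 1 ∧
      (k : ℕ) = blockStart (2 ^ d) n (blk d p 1) + (m + x) := by
  rw [part_eq_iff k.pos]
  unfold sumEnd at *
  omega

lemma roundTask_ready {e : Proc s → Fin n × Fin n} (hq : q < layerBase s d)
    (hA : ∀ p, loc d p 2 < layerBase s d * layerBase s d →
      τ p 5 = σ (setLoc d p 2 (loc d p 2 / layerBase s d * layerBase s d + q)) 3)
    (hB : ∀ p, loc d p 2 < layerBase s d * layerBase s d →
      τ p 7 = σ (setLoc d p 2 (q * layerBase s d + loc d p 2 % layerBase s d)) 4)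
    (hσ : Distributed d ci ck cj σ)
    (hacc : Accumulated d ci cj (ck * chunk s d + q * subEdge s d) τ) :
    (roundTask d ci cj (ck * chunk s d + q * subEdge s d) e).Ready d layerRegs τ where
  len_le p _ := by
    simp only [roundTask, sumEnd]
    omega
  loc_zero_lt _ hp := hp.loc_lt 0
  loc_one_lt _ hp := hp.loc_lt 1
  lo_le p _ := blockStart_le_sumEnd p _
  add_len_le p _ := (Nat.add_sub_of_le (sumEnd_mono p (Nat.le_add_right _ _))).trans_le
    ((sumEnd_le p _).trans (blockStart_blk_succ_le p 1))
  entryA p hp k x hx hk := by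
    obtain ⟨hxL, hpart, hk⟩ := lt_of_lt_len hx hk
    have hlayer : loc d (setLoc d p 1 x) 2 = loc d p 2 := loc_setLoc_of_ne p x (by decide)
    refine (hA _ (hlayer ▸ hp.layer_lt)).trans (hσ.entryA _ _ _ ?_)
    rw [hlayer]
    exact hp.operandA hq hxL hpart (by omega)
  entryB p hp k x hx hk := by
    obtain ⟨hxL, hpart, hk⟩ := lt_of_lt_len hx hk
    have hlayer : loc d (setLoc d p 0 x) 2 = loc d p 2 := loc_setLoc_of_ne p x (by decide)
    refine (hB _ (hlayer ▸ hp.layer_lt)).trans (hσ.entryB _ _ _ ?_)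
    rw [hlayer]
    exact hp.operandB hq hxL hpart (by omega)
  acc p hp := hacc _ _ p hp
  inSubcube p hp k hlo hhi := by
    have hend := sumEnd_le (n := n) (d := d) p (ck * chunk s d + q * subEdge s d + subEdge s d)
    have hmono := sumEnd_mono (n := n) (d := d) p
      (Nat.le_add_right (ck * chunk s d + q * subEdge s d) (subEdge s d))
    refine ⟨hp.row_part, (part_eq_iff k.pos).2 ⟨hlo, ?_⟩, hp.col_part⟩
    simp only [roundTask] at hhi
    change (k : ℕ) < blockStart (2 ^ d) n (blk d p 1 + 1)
    omega

lemma setLoc_near (p : Proc s) (a : Fin 3) {x : ℕ} (hp : loc d p a < subEdge s d)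
    (hx : x < subEdge s d) : (∀ b, b ≠ a → setLoc d p a x b = p b) ∧
      (setLoc d p a x a : ℕ) ≤ p a + subEdge s d ∧ (p a : ℕ) ≤ setLoc d p a x a + subEdge s d := by
  have hset : (setLoc d p a x a : ℕ) = _ := place_self p (blk_lt p a) hx
  have hloc := blockStart_add_loc (d := d) p a
  exact ⟨fun b hb => place_of_ne p _ _ hb, by omega, by omega⟩

lemma exists_entry_of_isHome (hn : 0 < n) (d ci cj : ℕ) : ∃ e : Proc s → Fin n × Fin n,
    ∀ i j p, IsHome d 0 2 ci cj i j p → e p = (i, j) := by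
  have hunique (p : Proc s) :
      ∃ e : Fin n × Fin n, ∀ i j, IsHome d 0 2 ci cj i j p → e = (i, j) := by
    by_cases h : ∃ i j : Fin n, IsHome d 0 2 ci cj i j p
    · obtain ⟨i, j, h⟩ := h
      exact ⟨(i, j), fun i' j' h' => Prod.ext (h.entry_unique h').1 (h.entry_unique h').2⟩
    · exact ⟨(⟨0, hn⟩, ⟨0, hn⟩), fun i j h' => absurd ⟨i, j, h'⟩ h⟩
  choose e he using hunique
  exact ⟨e, fun i j p => he p i j⟩

/- In the layer with the digits `(b, b')`, the square `(b, q)` of the chunk of `A` is multiplied by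
the square `(q, b')` of the chunk of `B`. -/
lemma reach_round (hn : 0 < n) (hq : q < layerBase s d) (hσ : Distributed d ci ck cj σ)
    (hacc : Accumulated d ci cj (ck * chunk s d + q * subEdge s d) σ) :
    Reach d (fun τ => Accumulated d ci cj (ck * chunk s d + (q + 1) * subEdge s d) τ ∧
      ∀ p r, r ∉ [5, 6, 7, 8, 9, 10, 13] → τ p r = σ p r) (10 * subEdge s d + 4) σ := by
  have hedge {x y : ℕ} (hx : x < layerBase s d) (hy : y < layerBase s d) :
      x * layerBase s d + y < subEdge s d := (two_digits_lt hx hy).trans_le (Nat.sqrt_le _)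
  obtain ⟨e, he⟩ := exists_entry_of_isHome (s := s) hn d ci cj
  refine ((reach_fetch (src := 3) (dst := 5) (tmp := 13) 2 (by decide) (by decide) (by decide)
      (M := fun p => loc d p 2 < layerBase s d * layerBase s d)
      (G := fun p => setLoc d p 2 (loc d p 2 / layerBase s d * layerBase s d + q)) (subEdge s d)
      (fun p hp => setLoc_near p 2 (hp.trans_le (Nat.sqrt_le _))
        (hedge ((Nat.div_lt_iff_lt_mul (by omega)).2 hp) hq)) σ).bind fun σ₁ h₁ =>
    (reach_fetch (src := 4) (dst := 7) (tmp := 13) 2 (by decide) (by decide) (by decide)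
      (M := fun p => loc d p 2 < layerBase s d * layerBase s d)
      (G := fun p => setLoc d p 2 (q * layerBase s d + loc d p 2 % layerBase s d)) (subEdge s d)
      (fun p hp => setLoc_near p 2 (hp.trans_le (Nat.sqrt_le _))
        (hedge hq (Nat.mod_lt _ (by omega)))) σ₁).bind fun σ₂ h₂ =>
    (reach_layer_product (roundTask d ci cj (ck * chunk s d + q * subEdge s d) e) layerRegs
      (roundTask_ready hq (fun p hp => ?_) (fun p hp => ?_) hσ (fun i j p hp => ?_))).weaken le_rfl
      fun τ hτ => ⟨fun i j p hp => ?_, fun p r hr => ?_⟩).weaken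
      (by omega : _ ≤ 10 * subEdge s d + 4) fun _ h => h
  · rw [h₂.other _ _ (by decide) (by decide), h₁.fetched p hp]
  · rw [h₂.fetched p hp, h₁.other _ _ (by decide) (by decide)]
  · rw [h₂.other _ _ (by decide) (by decide), h₁.other _ _ (by decide) (by decide)]
    exact hacc i j p hp
  · have hsum := hτ.1 p (show IsHome d 0 2 ci cj (e p).1 (e p).2 p by rwa [he i j p hp])
    simp only [roundTask, he i j p hp] at hsum
    rwa [Nat.add_sub_of_le (sumEnd_mono p (Nat.le_add_right _ _)), add_assoc, ← add_one_mul] at hsum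
  · have hregs : ∀ x, r ≠ layerRegs x := fun x hx => hr (hx ▸ by cases x <;> decide)
    simp only [List.mem_cons, List.not_mem_nil, or_false, not_or] at hr
    rw [hτ.2 p r hregs, h₂.other p r (by simp [hr]) (by simp [hr]),
      h₁.other p r (by simp [hr]) (by simp [hr])]

/-- The given entries are where the layouts prescribe. -/
structure InputKept (LA LB : Layout n s) (σ : TermRegs n s 14) : Prop where
  entryA : ∀ i k, σ (LA (i, k)) 0 = some (.entryA i k)
  entryB : ∀ k j, σ (LB (k, j)) 1 = some (.entryB k j)

lemma InputKept.congr {LA LB : Layout n s} (h : InputKept LA LB σ) (h0 : ∀ p, τ p 0 = σ p 0)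
    (h1 : ∀ p, τ p 1 = σ p 1) : InputKept LA LB τ :=
  ⟨fun i k => (h0 _).trans (h.entryA i k), fun k j => (h1 _).trans (h.entryB k j)⟩

lemma reach_distribute_operands {LA LB : Layout n s} (hσ : InputKept LA LB σ) (ci ck cj : ℕ) :
    Reach d (fun τ => Distributed d ci ck cj τ ∧ ∀ p r, r ∈ [0, 1, 2, 10] → τ p r = σ p r)
      (24 * s + 24) σ := by
  refine ((reach_distribute (β := 0) (γ := 1) (φ := 2) (by decide) (by decide) (by decide) ci ck LA
      Term.entryA (src := 0) (dst := 3) (mid := 5) (x := 11) (y := 12) (tmp := 13) (by decide) σ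
      hσ.entryA).bind fun σ₁ h₁ =>
    (reach_distribute (β := 1) (γ := 2) (φ := 0) (by decide) (by decide) (by decide) ck cj LB
      Term.entryB (src := 1) (dst := 4) (mid := 5) (x := 11) (y := 12) (tmp := 13) (by decide) σ₁
      fun k j => (h₁.2 _ _ (by decide)).trans (hσ.entryB k j)).weaken le_rfl
      fun τ hτ => ⟨⟨fun i k p hp => ?_, hτ.1⟩, fun p r hr => ?_⟩).weaken (by omega) fun _ h => h
  · rw [hτ.2 _ _ (by decide), h₁.1 i k p hp]
  · rw [hτ.2 p r (by revert r; decide), h₁.2 p r (by revert r; decide)]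

lemma reach_chunk_product (hn : 0 < n) {LA LB : Layout n s} (hσ : InputKept LA LB σ)
    (hacc : Accumulated d ci cj (ck * chunk s d) σ) :
    Reach d (fun τ => Accumulated d ci cj ((ck + 1) * chunk s d) τ ∧
      ∀ p r, r ∈ [0, 1, 2] → τ p r = σ p r)
      (24 * s + 24 + layerBase s d * (10 * subEdge s d + 4)) σ := by
  let Inv (q : ℕ) (τ : TermRegs n s 14) : Prop := Distributed d ci ck cj τ ∧
    Accumulated d ci cj (ck * chunk s d + q * subEdge s d) τ ∧
    ∀ p r, r ∈ [0, 1, 2] → τ p r = σ p r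
  refine (reach_distribute_operands hσ ci ck cj).bind fun σ₁ h₁ =>
    (Reach.loop (Inv := Inv) (layerBase s d) ?_ ?_).weaken le_rfl fun τ hτ => ⟨?_, hτ.2.2⟩
  · rintro q hq τ ⟨hdist, hsum, hkept⟩
    refine (reach_round hn hq hdist hsum).weaken le_rfl fun ρ hρ => ⟨?_, hρ.1, fun p r hr => ?_⟩
    · exact ⟨fun i k p hp => (hρ.2 _ _ (by decide)).trans (hdist.entryA i k p hp),
        fun k j p hp => (hρ.2 _ _ (by decide)).trans (hdist.entryB k j p hp)⟩
    · rw [hρ.2 p r (by revert r; decide), hkept p r hr]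
  · refine ⟨h₁.1, fun i j p hp => ?_, fun p r hr => h₁.2 p r (by revert r; decide)⟩
    rw [h₁.2 _ _ (by decide), zero_mul, add_zero]
    exact hacc i j p hp
  · convert hτ.2.1 using 1
    rw [add_one_mul, mul_comm (layerBase s d), chunk]

end ChunkProduct

/-! ### The recursive addition -/

section RecursiveAddition

variable {s n d : ℕ} {c c' e : ℕ} {σ τ : TermRegs n s 14} {p : Proc s} {i j : Fin n}

/-- The homes of `C` whose block number on the axis of summation is divisible by `2 ^ e` hold the
sums over the ranges of `2 ^ e` blocks. -/
def TreeSum (d c c' e : ℕ) (σ : TermRegs n s 14) : Prop :=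
  ∀ i j p, IsHome d 0 2 c c' i j p → 2 ^ e ∣ blk d p 1 →
    Holds i j (blockStart (2 ^ d) n (blk d p 1)) (blockStart (2 ^ d) n (blk d p 1 + 2 ^ e)) (σ p 10)

/-- The processor in the place of `p` in the subcube that is `2 ^ e` subcubes further on the axis of
summation. -/
def partner (d e : ℕ) (p : Proc s) : Proc s := place d p 1 (blk d p 1 + 2 ^ e) (loc d p 1)

lemma add_two_pow_lt {K : ℕ} (hK : K < 2 ^ d) (he : e < d) (hdvd : 2 ^ (e + 1) ∣ K) :
    K + 2 ^ e < 2 ^ d := by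
  have hle : K + 2 ^ (e + 1) ≤ 2 ^ d := by
    obtain ⟨m, rfl⟩ := hdvd
    obtain ⟨f, rfl⟩ := Nat.exists_eq_add_of_le (Nat.succ_le_of_lt he)
    rw [Nat.succ_eq_add_one, pow_add _ (e + 1)] at hK ⊢
    exact Nat.mul_le_mul_left _ (Nat.lt_of_mul_lt_mul_left hK)
  have hpos : 0 < 2 ^ e := by positivity
  rw [pow_succ] at hle
  omega

lemma div_eq_div_iff_of_dvd {P K w : ℕ} (hw : 0 < w) (hK : w ∣ K) :
    P / w = K / w ↔ K ≤ P ∧ P < K + w := by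
  obtain ⟨m, rfl⟩ := hK
  rw [Nat.mul_div_cancel_left m hw, Nat.div_eq_iff hw, mul_comm w]
  omega

lemma div_eq_div_iff_even {P K w : ℕ} (hw : 0 < w) (hK : 2 * w ∣ K) :
    P / w = K / w ↔ P / (2 * w) = K / (2 * w) ∧ P / w % 2 = 0 := by
  obtain ⟨m, rfl⟩ := hK
  rw [Nat.mul_div_cancel_left m (by omega), mul_comm 2 w, ← Nat.div_div_eq_div_mul, mul_assoc,
    Nat.mul_div_cancel_left _ hw]
  omega

lemma TreeSum.exists_halves (hn : 2 ^ d ≤ n) (he : e < d) (hσ : TreeSum d c c' e σ)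
    (hp : IsHome d 0 2 c c' i j p) (hdvd : 2 ^ (e + 1) ∣ blk d p 1) :
    ∃ u v, σ p 10 = some u ∧ σ (partner d e p) 10 = some v ∧
      PartialSum i j (blockStart (2 ^ d) n (blk d p 1))
        (blockStart (2 ^ d) n (blk d p 1 + 2 ^ e)) u ∧
      PartialSum i j (blockStart (2 ^ d) n (blk d p 1 + 2 ^ e))
        (blockStart (2 ^ d) n (blk d p 1 + 2 ^ (e + 1))) v := by
  have hlt (K : ℕ) : blockStart (2 ^ d) n K < blockStart (2 ^ d) n (K + 2 ^ e) :=
    (blockStart_lt_succ (by positivity) hn).trans_le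
      (blockStart_mono (Nat.add_le_add_left Nat.one_le_two_pow K))
  have hdvd' : 2 ^ e ∣ blk d p 1 := (pow_dvd_pow 2 (Nat.le_succ e)).trans hdvd
  have hpartner := add_two_pow_lt (blk_lt p 1) he hdvd
  have hblk : blk d (partner d e p) 1 = blk d p 1 + 2 ^ e :=
    blk_place_self p hpartner (hp.loc_lt 1)
  obtain ⟨u, hu, hu'⟩ := hσ i j p hp hdvd' (hlt _)
  obtain ⟨v, hv, hv'⟩ := hσ i j (partner d e p) (hp.place (by decide) (by decide) hpartner)
    (hblk ▸ hdvd'.add dvd_rfl) (hlt _)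
  rw [hblk, add_assoc, ← two_mul, ← pow_succ'] at hv'
  exact ⟨u, v, hu, hv, hu', hv'⟩

lemma allowedPlus_halves {u v : Term n} (he : e < d) (hp : IsHome d 0 2 c c' i j p)
    (hdvd : 2 ^ (e + 1) ∣ blk d p 1)
    (hu : PartialSum i j (blockStart (2 ^ d) n (blk d p 1))
      (blockStart (2 ^ d) n (blk d p 1 + 2 ^ e)) u)
    (hv : PartialSum i j (blockStart (2 ^ d) n (blk d p 1 + 2 ^ e))
      (blockStart (2 ^ d) n (blk d p 1 + 2 ^ (e + 1))) v) : AllowedPlus d p u v := by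
  have hrange (w : ℕ) (k : Fin n) : (blockStart (2 ^ d) n (blk d p 1) ≤ k ∧
      (k : ℕ) < blockStart (2 ^ d) n (blk d p 1 + w)) ↔
      blk d p 1 ≤ part n d k ∧ part n d k < blk d p 1 + w := by
    rw [blockStart_le_iff (by positivity) k.pos, lt_blockStart_iff (by positivity) k.pos, part]
  have hsub (k : Fin n) : InSubcube (d - (e + 1)) p i k j ↔
      part n d k / 2 ^ (e + 1) = blk d p 1 / 2 ^ (e + 1) := by
    simp only [InSubcube, part_of_le (Nat.sub_le d (e + 1)), hp.row_part, hp.col_part,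
      Nat.sub_sub_self (Nat.succ_le_of_lt he)]
    exact ⟨fun h => h.2.1, fun h => ⟨rfl, h, rfl⟩⟩
  refine ⟨i, j, _, _, _, hu, hv, .inr ⟨d - (e + 1), by omega, fun k => ?_, fun k => ?_⟩⟩
  · rw [hrange, hsub, div_eq_div_iff_of_dvd (by positivity) hdvd]
  · rw [pow_succ'] at hdvd
    rw [hrange, hsub, ← div_eq_div_iff_of_dvd (by positivity) (dvd_of_mul_left_dvd hdvd),
      div_eq_div_iff_even (by positivity) hdvd, pow_succ',
      part_of_le (show d - (e + 1) + 1 ≤ d by omega), show d - (d - (e + 1) + 1) = e by omega]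

lemma partner_near (hp : loc d p 1 < subEdge s d) (hblk : blk d p 1 + 2 ^ e < 2 ^ d) :
    (∀ b, b ≠ 1 → partner d e p b = p b) ∧
      (partner d e p 1 : ℕ) ≤ p 1 + (2 ^ e * s / 2 ^ d + 1) ∧
      (p 1 : ℕ) ≤ partner d e p 1 + (2 ^ e * s / 2 ^ d + 1) := by
  have hpartner : (partner d e p 1 : ℕ) = _ := place_self p hblk hp
  have hloc := blockStart_add_loc (d := d) p 1
  have hle := blockStart_add_le (D := 2 ^ d) (N := s) (K := blk d p 1) (by positivity) (2 ^ e)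
  have hmono := blockStart_mono (D := 2 ^ d) (N := s) (Nat.le_add_right (blk d p 1) (2 ^ e))
  exact ⟨fun b hb => place_of_ne p _ _ hb, by omega, by omega⟩

lemma reach_tree_level (hn : 2 ^ d ≤ n) (he : e < d) (hσ : TreeSum d c c' e σ) :
    Reach d (fun τ => TreeSum d c c' (e + 1) τ ∧ ∀ p r, r ∈ [0, 1, 2] → τ p r = σ p r)
      (2 * (2 ^ e * s / 2 ^ d) + 5) σ := by
  classical
  let M (p : Proc s) : Prop := (∃ i j : Fin n, IsHome d 0 2 c c' i j p) ∧ 2 ^ (e + 1) ∣ blk d p 1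
  refine ((reach_fetch (src := 10) (dst := 5) (tmp := 13) 1 (by decide) (by decide) (by decide)
    (M := M) (G := partner d e) (2 ^ e * s / 2 ^ d + 1) ?_ σ).bind fun σ₁ h₁ =>
    (reach_applyOps (op := fun p => if M p then some ⟨.plus, 10, 5, 10⟩ else none) ?_).weaken le_rfl
    fun τ hτ => ?_).weaken (by omega : _ ≤ 2 * (2 ^ e * s / 2 ^ d) + 5) fun _ h => h
  · rintro p ⟨⟨i, j, hp⟩, hdvd⟩
    exact partner_near (hp.loc_lt 1) (add_two_pow_lt (blk_lt p 1) he hdvd)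
  · intro p I u v hI hu hv
    simp only [Option.ite_none_right_eq_some, Option.some.injEq] at hI
    obtain ⟨hM, rfl⟩ := hI
    have ⟨⟨i, j, hp⟩, hdvd⟩ := hM
    obtain ⟨u', v', hu', hv', hsum, hsum'⟩ := hσ.exists_halves hn he hp hdvd
    change σ₁ p 10 = some u at hu
    change σ₁ p 5 = some v at hv
    rw [h₁.other _ _ (by decide) (by decide), hu', Option.some.injEq] at hu
    rw [h₁.fetched p hM, hv', Option.some.injEq] at hv
    exact ⟨nofun, fun _ => hu ▸ hv ▸ allowedPlus_halves he hp hdvd hsum hsum'⟩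
  · subst hτ
    refine ⟨fun i j p hp hdvd _ => ?_, fun p r hr => ?_⟩
    · have hM : M p := ⟨⟨i, j, hp⟩, hdvd⟩
      obtain ⟨u, v, hu, hv, hsum, hsum'⟩ := hσ.exists_halves hn he hp hdvd
      have hu₁ : σ₁ p 10 = some u := (h₁.other _ _ (by decide) (by decide)).trans hu
      have hv₁ : σ₁ p 5 = some v := (h₁.fetched p hM).trans hv
      exact ⟨.plus u v, by simp [applyOps, execStep, loadRegs, OpKind.fn, hM, hu₁, hv₁],
        .plus hsum hsum'⟩
    · have hr' : r ≠ 10 ∧ r ≠ 5 ∧ r ∉ [13] := by revert r; decide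
      rw [← h₁.other p r hr'.2.1 hr'.2.2]
      by_cases hM : M p <;> simp [applyOps, execStep, loadRegs, hM, hr'.1]

lemma sum_level_cost_le (s d m : ℕ) : ∑ e ∈ range m, (2 * (2 ^ e * s / 2 ^ d) + 5) ≤
    2 * (2 ^ m * s / 2 ^ d) + 5 * m := by
  induction m with
  | zero => simp
  | succ m ih =>
    have hdouble := Nat.div_add_div_le_add_div (x := 2 ^ m * s) (y := 2 ^ m * s) (z := 2 ^ d)
    rw [← two_mul (_ * s), ← mul_assoc, ← pow_succ'] at hdouble
    rw [sum_range_succ]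
    omega

lemma reach_tree (hn : 2 ^ d ≤ n) (hσ : TreeSum d c c' 0 σ) :
    Reach d (fun τ => TreeSum d c c' d τ ∧ ∀ p r, r ∈ [0, 1, 2] → τ p r = σ p r)
      (2 * s + 5 * d) σ := by
  have hcost := sum_level_cost_le s d d
  rw [Nat.mul_div_cancel_left s (by positivity)] at hcost
  exact (Reach.loop_sum
    (Inv := fun e τ => TreeSum d c c' e τ ∧ ∀ p r, r ∈ [0, 1, 2] → τ p r = σ p r) d _
    (fun e he τ hτ => (reach_tree_level hn he hτ.1).weaken le_rfl fun ρ hρ =>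
      ⟨hρ.1, fun p r hr => (hρ.2 p r hr).trans (hτ.2 p r hr)⟩)
    ⟨hσ, fun _ _ _ => rfl⟩).weaken hcost fun _ h => h

end RecursiveAddition

/-! ### The whole algorithm -/

section Algorithm

variable {s n d : ℕ} {c c' N : ℕ} {σ τ : TermRegs n s 14} {p : Proc s} {i j : Fin n}
  {LA LB LC : Layout n s}

/-- The result `C(i,j)` is where the layout prescribes. -/
def HasResult (LC : Layout n s) (i j : Fin n) (σ : TermRegs n s 14) : Prop :=
  ∃ u, σ (LC (i, j)) 2 = some u ∧ PartialSum i j 0 n u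

lemma HasResult.congr (h : HasResult LC i j σ) (hστ : τ (LC (i, j)) 2 = σ (LC (i, j)) 2) :
    HasResult LC i j τ := by
  rwa [HasResult, hστ]

/-- The results with homes for the chunk numbers `(c, c')` are where the layout prescribes. -/
def ChunkDone (d : ℕ) (LC : Layout n s) (c c' : ℕ) (σ : TermRegs n s 14) : Prop :=
  ∀ i j (p : Proc s), IsHome d 0 2 c c' i j p → blk d p 1 = 0 → HasResult LC i j σ

lemma TreeSum.exists_result (hσ : TreeSum d c c' d σ) (hp : IsHome d 0 2 c c' i j p)
    (h0 : blk d p 1 = 0) : ∃ u, σ p 10 = some u ∧ PartialSum i j 0 n u := by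
  have hsum := hσ i j p hp (h0 ▸ dvd_zero _)
  rw [h0, zero_add, blockStart_zero, blockStart_self (by positivity)] at hsum
  exact hsum i.pos

lemma reach_deliver (LC : Layout n s) (hσ : TreeSum d c c' d σ) :
    Reach d (fun τ => ChunkDone d LC c c' τ ∧ (∀ i j, HasResult LC i j σ → HasResult LC i j τ) ∧
      ∀ p r, r ∈ [0, 1] → τ p r = σ p r) (10 * s + 10) σ := by
  obtain ⟨π, hπ⟩ := exists_perm_of_layout (d := d) (β := 0) (γ := 2) (φ := 1) (by decide) c c' LC
  let M (q : Proc s) : Prop :=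
    ∃ (i j : Fin n) (p : Proc s), IsHome d 0 2 c c' i j p ∧ blk d p 1 = 0 ∧ LC (i, j) = q
  refine (reach_permute π.symm (src := 10) (dst := 2) (x := 11) (y := 12) (tmp := 13) (by decide)
    M σ).weaken le_rfl fun τ hτ => ?_
  have hdone : ChunkDone d LC c c' τ := by
    intro i j p hp h0
    obtain ⟨u, hu, hsum⟩ := hσ.exists_result hp h0
    refine ⟨u, ?_, hsum⟩
    rw [hτ.fetched _ ⟨i, j, p, hp, h0, rfl⟩, ← hπ p i j hp h0, Equiv.symm_apply_apply, hu]
  refine ⟨hdone, fun i j hij => ?_, fun p r hr => hτ.other p r ?_ ?_⟩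
  · by_cases hM : M (LC (i, j))
    · obtain ⟨i', j', p, hp, h0, heq⟩ := hM
      obtain ⟨rfl, rfl⟩ := Prod.mk.inj (LC.injective heq)
      exact hdone _ _ p hp h0
    · exact hij.congr (hτ.kept _ hM)
  all_goals revert r; decide

lemma accumulated_zero (d c c' : ℕ) (σ : TermRegs n s 14) : Accumulated d c c' 0 σ :=
  fun _ _ _ _ h => absurd h (min_le_left _ _).not_gt

lemma Accumulated.treeSum_zero (hN : n / 2 ^ d + 1 ≤ N * chunk s d)
    (h : Accumulated d c c' (N * chunk s d) σ) : TreeSum d c c' 0 σ := by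
  intro i j p hp _
  have hlen := blockStart_add_le (D := 2 ^ d) (N := n) (K := blk d p 1) (by positivity) 1
  have hend : sumEnd n d p (N * chunk s d) = blockStart (2 ^ d) n (blk d p 1 + 2 ^ 0) := by
    rw [one_mul] at hlen
    rw [sumEnd, pow_zero]
    omega
  exact hend ▸ h i j p hp

lemma reach_chunk (hn : 2 ^ d ≤ n) (hN : n / 2 ^ d + 1 ≤ N * chunk s d) (LC : Layout n s)
    (c c' : ℕ) (hσ : InputKept LA LB σ) :
    Reach d (fun τ => InputKept LA LB τ ∧ ChunkDone d LC c c' τ ∧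
      ∀ i j, HasResult LC i j σ → HasResult LC i j τ)
      (N * (24 * s + 24 + layerBase s d * (10 * subEdge s d + 4)) + (2 * s + 5 * d) +
        (10 * s + 10)) σ := by
  have hn0 : 0 < n := hn.trans_lt' (by positivity)
  let Inv (ck : ℕ) (τ : TermRegs n s 14) : Prop :=
    InputKept LA LB τ ∧ Accumulated d c c' (ck * chunk s d) τ ∧ ∀ p, τ p 2 = σ p 2
  have hloop : Reach d (Inv N) _ σ := .loop N
    (fun ck _ τ ⟨hin, hacc, hkept⟩ => (reach_chunk_product hn0 hin hacc).weaken le_rfl fun ρ hρ =>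
      ⟨hin.congr (fun p => hρ.2 p 0 (by decide)) (fun p => hρ.2 p 1 (by decide)), hρ.1,
        fun p => (hρ.2 p 2 (by decide)).trans (hkept p)⟩)
    ⟨hσ, (zero_mul (chunk s d)).symm ▸ accumulated_zero d c c' σ, fun _ => rfl⟩
  refine (hloop.bind fun σ₁ ⟨hin, hacc, hkept⟩ => (reach_tree hn (hacc.treeSum_zero hN)).bind
    fun σ₂ ⟨htree, hkept₂⟩ => (reach_deliver LC htree).weaken le_rfl
      fun τ ⟨hdone, hresult, hkept₃⟩ => ⟨hin.congr (fun p => ?_) (fun p => ?_), hdone,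
        fun i j hij => hresult i j (hij.congr ?_)⟩).weaken (add_assoc _ _ _).ge fun _ h => h
  · rw [hkept₃ p 0 (by decide), hkept₂ p 0 (by decide)]
  · rw [hkept₃ p 1 (by decide), hkept₂ p 1 (by decide)]
  · rw [hkept₂ _ 2 (by decide), hkept]

lemma reach_product (hn : 2 ^ d ≤ n) (hs : 2 ^ d ≤ s) (hN : n / 2 ^ d + 1 ≤ N * chunk s d)
    (LC : Layout n s) (hσ : InputKept LA LB σ) :
    Reach d (ProductStored LC 2)
      (N * N * (N * (24 * s + 24 + layerBase s d * (10 * subEdge s d + 4)) + (2 * s + 5 * d) +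
        (10 * s + 10))) σ := by
  let Inv (m : ℕ) (τ : TermRegs n s 14) : Prop :=
    InputKept LA LB τ ∧ ∀ c c', c' < N → c * N + c' < m → ChunkDone d LC c c' τ
  refine (Reach.loop (Inv := Inv) (N * N) (fun m hm τ hτ =>
    (reach_chunk hn hN LC (m / N) (m % N) hτ.1).weaken le_rfl fun ρ hρ =>
      ⟨hρ.1, fun c c' hc' hlt => ?_⟩) ⟨hσ, fun _ _ _ h => absurd h (Nat.not_lt_zero _)⟩).weaken
    le_rfl fun τ hτ i j => ?_
  · rcases Nat.lt_succ_iff_lt_or_eq.1 hlt with hlt | rfl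
    · exact fun i j p hp h0 => hρ.2.2 i j (hτ.2 c c' hc' hlt i j p hp h0)
    · convert hρ.2.1 using 1
      · rw [eq_comm, Nat.div_eq_iff (by omega)]
        omega
      · rw [Nat.mul_add_mod', Nat.mod_eq_of_lt hc']
  · obtain ⟨c, hc, c', hc', p, hp, h0⟩ := exists_isHome (β := 0) (γ := 2) (φ := 1)
      (by decide) (by decide) (by decide) hs hN i j
    exact hτ.2 c c' hc' (two_digits_lt hc hc') i j p hp h0

end Algorithm

/-! ### Lower bounds -/

section LowerBound

variable {s n : ℕ}

/-- The processors `p` and `q` differ by at most `t` in every coordinate. This is the region that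
information can cross in `t` steps, and unlike the graph distance it has cubes as balls. -/
def Near (t : ℕ) (p q : Proc s) : Prop :=
  ∀ a, (p a : ℕ) ≤ q a + t ∧ (q a : ℕ) ≤ p a + t

lemma Near.refl (t : ℕ) (p : Proc s) : Near t p p := fun _ => ⟨by lia, by lia⟩

lemma Near.symm {t : ℕ} {p q : Proc s} (h : Near t p q) : Near t q p :=
  fun a => ⟨(h a).2, (h a).1⟩

lemma Near.trans {t t' : ℕ} {p q q' : Proc s} (h : Near t p q) (h' : Near t' q q') :
    Near (t + t') p q' :=
  fun a => by have := h a; have := h' a; lia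

lemma Near.mono {t t' : ℕ} {p q : Proc s} (h : Near t p q) (ht : t ≤ t') : Near t' p q :=
  fun a => by have := h a; lia

lemma near_of_nbr {p q : Proc s} {d : Dir} (h : nbr p d = some q) : Near 1 p q := by
  intro a
  unfold nbr at h
  split_ifs at h <;> cases h <;> by_cases ha : a = d.1
  · subst ha; simp; lia
  · simp [Function.update_of_ne ha]
  · subst ha; simp; lia
  · simp [Function.update_of_ne ha]

lemma card_le_of_near {t : ℕ} {p : Proc s} {S : Finset (Proc s)} (hS : ∀ q ∈ S, Near t q p) :
    #S ≤ (2 * t + 1) ^ 3 := by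
  have hcard : #S ≤ #(Fintype.piFinset fun a => Finset.Icc (p a - t : ℤ) (p a + t)) := by
    refine Finset.card_le_card_of_injOn (fun q a => (q a : ℤ)) (fun q hq => ?_) fun q _ q' _ h => ?_
    · refine mem_coe.2 (Fintype.mem_piFinset.2 fun a => Finset.mem_Icc.2 ?_)
      have := hS q hq a
      lia
    · exact funext fun a => Fin.ext (Int.ofNat_inj.1 (congrFun h a))
  have hside (a : ℤ) : (a + t + 1 - (a - t)).toNat = 2 * t + 1 := by lia
  simpa only [Fintype.card_piFinset, Int.card_Icc, hside, prod_const, card_univ, Fintype.card_fin]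
    using hcard

/-- Elements that record where they come from: an entry of one of the matrices, or a sum of scalar
products, of which the index triples `(i, k, j)` of the summands `A(i,k) ⊗ B(k,j)` are recorded. -/
inductive Provenance (n : ℕ) : Type u
  | entryA (i k : Fin n)
  | entryB (k j : Fin n)
  | sum (products : Set (Fin n × Fin n × Fin n))

namespace Provenance

/-- The scalar products contained in an element. -/
def products : Provenance.{u} n → Set (Fin n × Fin n × Fin n)
  | sum S => S
  | _ => ∅

/-- Addition unites the recorded products. -/
def add (x y : Provenance.{u} n) : Provenance.{u} n := sum (x.products ∪ y.products)

/-- Multiplication records the product of an entry of `A` and a matching entry of `B`; any other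
product contains nothing. -/
def mul (x y : Provenance.{u} n) : Provenance.{u} n :=
  sum {τ | x = entryA τ.1 τ.2.1 ∧ y = entryB τ.2.1 τ.2.2}

lemma add_assoc (x y z : Provenance.{u} n) : add (add x y) z = add x (add y z) :=
  congrArg sum (Set.union_assoc _ _ _)

lemma mem_products_foldl {τ : Fin n × Fin n × Fin n} {x : Provenance.{u} n}
    {l : List (Provenance.{u} n)} (h : ∃ y ∈ x :: l, τ ∈ y.products) :
    τ ∈ (l.foldl add x).products := by
  induction l generalizing x with
  | nil => simpa using h
  | cons y l ih =>
    refine ih ?_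
    obtain ⟨z, hz, hτ⟩ := h
    rcases List.mem_cons.1 hz with rfl | hz
    · exact ⟨_, List.mem_cons_self, .inl hτ⟩
    rcases List.mem_cons.1 hz with rfl | hz
    · exact ⟨_, List.mem_cons_self, .inr hτ⟩
    · exact ⟨z, List.mem_cons_of_mem _ hz, hτ⟩

lemma exists_generalProduct_eq_some (i k j : Fin n) :
    ∃ x, generalProduct add mul (Matrix.of entryA) (Matrix.of entryB.{u}) i j = some x ∧
      (i, k, j) ∈ x.products := by
  have hk : mul (entryA i k) (entryB k j) ∈
      (List.finRange n).map fun k => mul (entryA.{u} i k) (entryB k j) :=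
    List.mem_map_of_mem (List.mem_finRange k)
  have hτ : (i, k, j) ∈ (mul (entryA.{u} i k) (entryB k j)).products := ⟨rfl, rfl⟩
  unfold generalProduct
  simp only [Matrix.of_apply]
  cases h : (List.finRange n).map fun k => mul (entryA.{u} i k) (entryB k j) with
  | nil => simp [h] at hk
  | cons x l => exact ⟨_, rfl, mem_products_foldl ⟨_, h ▸ hk, hτ⟩⟩

end Provenance

open Provenance

variable {R w : ℕ} {P : Program s R w} {LA LB LC : Layout n s}

variable (P LA LB) in
/-- The computation on the matrices that record the provenance. -/
noncomputable abbrev provRun (t : ℕ) : Config s R P.Ctrl (Provenance.{u} n) :=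
  P.run add mul LA LB (Matrix.of entryA) (Matrix.of entryB) t

variable (P LA LB) in
/-- The scalar product `τ` is computed at the processor `q` in the step after time `t`. -/
def Makes (q : Proc s) (t : ℕ) (τ : Fin n × Fin n × Fin n) : Prop :=
  P.Executes (provRun.{u} P LA LB t) q .times (entryA τ.1 τ.2.1) (entryB τ.2.1 τ.2.2)

lemma Makes.unique {q : Proc s} {t : ℕ} {τ τ' : Fin n × Fin n × Fin n}
    (h : Makes.{u} P LA LB q t τ) (h' : Makes.{u} P LA LB q t τ') : τ = τ' := by
  obtain ⟨I, hI, -, hx, hy⟩ := h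
  obtain ⟨I', hI', -, hx', hy'⟩ := h'
  obtain rfl : I = I' := Option.some.inj (hI.symm.trans hI')
  have hA := Option.some.inj (hx.symm.trans hx')
  have hB := Option.some.inj (hy.symm.trans hy')
  simp only [entryA.injEq, entryB.injEq] at hA hB
  exact Prod.ext hA.1 (Prod.ext hA.2 hB.2)

lemma exists_reg_of_loaded {V : Type*} {c : Config s R P.Ctrl V} {p : Proc s} {r : Fin R} {x : V}
    (h : P.loaded c p r = some x) : ∃ q r', Near 1 p q ∧ c.reg q r' = some x := by
  unfold Program.loaded at h
  split at h
  · exact ⟨p, _, .refl _ _, h⟩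
  · simp only [Program.received, Option.bind_eq_some_iff] at h
    obtain ⟨q, hq, r', -, h⟩ := h
    exact ⟨q, r', near_of_nbr hq, h⟩
  · contradiction

/-- What locality implies for an element `x` held by the processor `p` at time `t`: an entry has
travelled at most `t` steps, and the scalar products in a sum have been computed near `p`, out of
entries that came from nearby. -/
structure Localized (P : Program s R w) (LA LB : Layout n s) (t : ℕ) (p : Proc s)
    (x : Provenance.{u} n) : Prop where
  nearA : ∀ i k, x = entryA i k → Near t p (LA (i, k))
  nearB : ∀ k j, x = entryB k j → Near t p (LB (k, j))
  made : ∀ τ ∈ x.products, ∃ q, ∃ t' < t, Makes.{u} P LA LB q t' τ ∧ Near t p q ∧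
    Near t q (LA (τ.1, τ.2.1)) ∧ Near t q (LB (τ.2.1, τ.2.2))

namespace Localized

variable {t : ℕ} {p : Proc s} {x y : Provenance.{u} n}

lemma of_near {q : Proc s} (h : Localized P LA LB t q x) (hpq : Near 1 p q) :
    Localized P LA LB (t + 1) p x where
  nearA i k he := (hpq.trans (h.nearA i k he)).mono (by lia)
  nearB k j he := (hpq.trans (h.nearB k j he)).mono (by lia)
  made τ hτ := by
    obtain ⟨q', t', ht', hmakes, hq', hA, hB⟩ := h.made τ hτ
    exact ⟨q', t', by lia, hmakes, (hpq.trans hq').mono (by lia), hA.mono (by lia),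
      hB.mono (by lia)⟩

lemma add (hx : Localized P LA LB t p x) (hy : Localized P LA LB t p y) :
    Localized P LA LB t p (x.add y) where
  nearA _ _ h := nomatch h
  nearB _ _ h := nomatch h
  made τ hτ := hτ.elim (hx.made τ) (hy.made τ)

lemma mul (hx : Localized P LA LB (t + 1) p x) (hy : Localized P LA LB (t + 1) p y)
    (h : P.Executes (provRun P LA LB t) p .times x y) :
    Localized P LA LB (t + 1) p (x.mul y) where
  nearA _ _ h := nomatch h
  nearB _ _ h := nomatch h
  made := by
    rintro τ ⟨rfl, rfl⟩
    exact ⟨p, t, t.lt_succ_self, h, .refl _ _, hx.nearA _ _ rfl, hy.nearB _ _ rfl⟩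

end Localized

lemma exists_of_stored_eq_some {V : Type*} {L : Layout n s} {M : Matrix (Fin n) (Fin n) V}
    {p : Proc s} {x : V} (h : stored L M p = some x) : ∃ i j, L (i, j) = p ∧ M i j = x := by
  obtain ⟨e, he, hx⟩ := Option.map_eq_some_iff.1 h
  exact ⟨e.1, e.2, (L.injective.isPartialInv e p).1 he, hx⟩

lemma localized_start {p : Proc s} {r : Fin R} {x : Provenance.{u} n}
    (h : (provRun.{u} P LA LB 0).reg p r = some x) : Localized P LA LB 0 p x := by
  simp only [provRun, Program.run, Function.iterate_zero, id, Program.start] at h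
  split_ifs at h
  · obtain ⟨i, k, rfl, rfl⟩ := exists_of_stored_eq_some h
    refine ⟨fun i' k' he => ?_, fun _ _ he => (nomatch he), fun _ hτ => nomatch hτ⟩
    obtain ⟨rfl, rfl⟩ := entryA.inj he
    exact .refl _ _
  · obtain ⟨k, j, rfl, rfl⟩ := exists_of_stored_eq_some h
    refine ⟨fun _ _ he => (nomatch he), fun k' j' he => ?_, fun _ hτ => nomatch hτ⟩
    obtain ⟨rfl, rfl⟩ := entryB.inj he
    exact .refl _ _

lemma localized_run {t : ℕ} {p : Proc s} {r : Fin R} {x : Provenance.{u} n}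
    (h : (provRun.{u} P LA LB t).reg p r = some x) : Localized P LA LB t p x := by
  induction t generalizing p r x with
  | zero => exact localized_start h
  | succ t ih =>
    have hload {r x} (hx : P.loaded (provRun.{u} P LA LB t) p r = some x) :
        Localized P LA LB (t + 1) p x := by
      obtain ⟨q, r', hq, hr'⟩ := exists_reg_of_loaded hx
      exact (ih hr').of_near hq
    rw [provRun, Program.run, Function.iterate_succ_apply', ← Program.run] at h
    simp only [Program.step, Program.computed] at h
    cases hI : (P.act ((provRun.{u} P LA LB t).ctrl p)).op with
    | none => exact hload (by simpa only [hI] using h)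
    | some I =>
      simp only [hI] at h
      rcases eq_or_ne r I.dest with rfl | hr
      · rw [Function.update_self, Option.map₂_eq_some_iff] at h
        obtain ⟨y, z, hy, hz, rfl⟩ := h
        cases hkind : I.kind with
        | plus => exact (hload hy).add (hload hz)
        | times => exact (hload hy).mul (hload hz) ⟨I, hI, hkind, hy, hz⟩
      · rw [Function.update_of_ne hr] at h
        exact hload h

section ComputesWithin

variable {T : ℕ}

lemma exists_makes (h : Program.ComputesWithin.{u} P LA LB LC T) (i k j : Fin n) :
    ∃ q, ∃ t < T, Makes.{u} P LA LB q t (i, k, j) ∧ Near T q (LA (i, k)) ∧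
      Near T q (LB (k, j)) ∧ Near T q (LC (i, j)) := by
  obtain ⟨t, ht, -, hC⟩ :=
    h (Provenance.{u} n) add mul add_assoc (Matrix.of entryA) (Matrix.of entryB)
  obtain ⟨x, hx, hmem⟩ := exists_generalProduct_eq_some.{u} i k j
  obtain ⟨q, t', ht', hmakes, hC, hA, hB⟩ := (localized_run ((hC i j).trans hx)).made _ hmem
  exact ⟨q, t', by lia, hmakes, hA.mono ht, hB.mono ht, hC.symm.mono ht⟩

lemma pow_three_le_card_mul {S : Finset (Proc s)}
    (h : ∀ i k j, ∃ q ∈ S, ∃ t < T, Makes.{u} P LA LB q t (i, k, j)) : n ^ 3 ≤ #S * T := by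
  choose q hq t ht hmakes using h
  calc n ^ 3 = #(univ : Finset (Fin n × Fin n × Fin n)) := by simp; ring
    _ ≤ #(S ×ˢ range T) := by
      refine card_le_card_of_injOn (fun τ => (q τ.1 τ.2.1 τ.2.2, t τ.1 τ.2.1 τ.2.2))
        (fun τ _ => by simp [hq, ht]) fun τ _ τ' _ hτ => ?_
      obtain ⟨heq_q, heq_t⟩ := Prod.mk.inj hτ
      exact (heq_q ▸ heq_t ▸ hmakes τ.1 τ.2.1 τ.2.2).unique (hmakes τ'.1 τ'.2.1 τ'.2.2)
    _ = #S * T := by rw [card_product, card_range]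

lemma pow_three_le_pow_three_mul_of_computesWithin
    (h : Program.ComputesWithin.{u} P LA LB LC T) : n ^ 3 ≤ s ^ 3 * T := by
  have hcard : #(univ : Finset (Proc s)) = s ^ 3 := by simp
  refine hcard ▸ pow_three_le_card_mul (P := P) (LA := LA) (LB := LB) fun i k j => ?_
  obtain ⟨q, t, ht, hmakes, -⟩ := exists_makes h i k j
  exact ⟨q, mem_univ q, t, ht, hmakes⟩

lemma exists_forall_makes_near [NeZero n] (h : Program.ComputesWithin.{u} P LA LB LC T) :
    ∃ o : Proc s, ∀ i k j, ∃ q, Near (5 * T) q o ∧ ∃ t < T, Makes.{u} P LA LB q t (i, k, j) := by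
  choose q t ht hmakes hA hB hC using exists_makes h
  refine ⟨LC (0, 0), fun i k j => ⟨q i k j, ?_, t i k j, ht i k j, hmakes i k j⟩⟩
  have hj : Near (2 * T) (q i k j) (q i k 0) :=
    ((hA i k j).trans (hA i k 0).symm).mono (by lia)
  have hi : Near (2 * T) (q i k 0) (q 0 k 0) :=
    ((hB i k 0).trans (hB 0 k 0).symm).mono (by lia)
  exact ((hj.trans hi).trans (hC 0 k 0)).mono (by lia)

lemma pow_three_le_of_computesWithin (h : Program.ComputesWithin.{u} P LA LB LC T) :
    n ^ 3 ≤ (10 * T + 1) ^ 3 * T := by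
  classical
  rcases Nat.eq_zero_or_pos n with rfl | hn
  · simp
  have : NeZero n := ⟨hn.ne'⟩
  obtain ⟨o, ho⟩ := exists_forall_makes_near h
  calc n ^ 3 ≤ #{q | Near (5 * T) q o} * T :=
      pow_three_le_card_mul.{u} (by simpa only [mem_filter_univ] using ho)
    _ ≤ (2 * (5 * T) + 1) ^ 3 * T :=
      Nat.mul_le_mul_right _ (card_le_of_near (p := o) fun q hq => (mem_filter_univ q).1 hq)
    _ = (10 * T + 1) ^ 3 * T := by ring

theorem rpow_le_of_computesWithin (h : Program.ComputesWithin.{u} P LA LB LC T) :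
    1 / 11 * (n : ℝ) ^ (3 / 4 : ℝ) ≤ T := by
  have hcube := pow_three_le_of_computesWithin h
  have hpow : n ^ 3 ≤ (11 * T) ^ 4 := by
    rcases Nat.eq_zero_or_pos T with rfl | hT
    · simpa using hcube
    calc n ^ 3 ≤ (10 * T + 1) ^ 3 * T := hcube
      _ ≤ (11 * T) ^ 3 * (11 * T) := by gcongr <;> lia
      _ = (11 * T) ^ 4 := by ring
  have hroot : (n : ℝ) ^ (3 / 4 : ℝ) ≤ 11 * T :=
    calc (n : ℝ) ^ (3 / 4 : ℝ) = ((n : ℝ) ^ 3) ^ (1 / 4 : ℝ) := by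
          rw [← Real.rpow_natCast, ← Real.rpow_mul (by positivity)]; norm_num
      _ ≤ ((11 * T : ℝ) ^ 4) ^ (1 / 4 : ℝ) := by gcongr; exact_mod_cast hpow
      _ = 11 * T := by
          rw [← Real.rpow_natCast, ← Real.rpow_mul (by positivity)]; norm_num
  linarith

end ComputesWithin

end LowerBound

/-! ### Sizes -/

section Sizes

variable {s d n : ℕ}

lemma subEdge_pos (hs : 2 ^ d ≤ s) : 0 < subEdge s d := Nat.div_pos hs (by positivity)

lemma chunk_pos (hs : 2 ^ d ≤ s) : 0 < chunk s d :=
  Nat.mul_pos (subEdge_pos hs) (Nat.sqrt_pos.2 (subEdge_pos hs))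

lemma chunk_le_sq (s d : ℕ) : chunk s d ≤ s ^ 2 := by
  have hsub : subEdge s d ≤ s := Nat.div_le_self s _
  rw [sq]
  exact Nat.mul_le_mul hsub ((Nat.sqrt_le_self _).trans hsub)

lemma chunk_sq_le (s d : ℕ) : chunk s d ^ 2 ≤ subEdge s d ^ 3 := by
  rw [chunk, mul_pow, pow_succ _ 2]
  exact Nat.mul_le_mul_left _ (Nat.sqrt_le' _)

lemma subEdge_pow_three_le (hs : 2 ^ d ≤ s) : subEdge s d ^ 3 ≤ 4 * chunk s d ^ 2 := by
  have hbase : 0 < layerBase s d := Nat.sqrt_pos.2 (subEdge_pos hs)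
  have hsq : subEdge s d ≤ 4 * layerBase s d ^ 2 := by
    calc subEdge s d ≤ (layerBase s d + 1) ^ 2 := (Nat.lt_succ_sqrt' _).le
      _ ≤ (2 * layerBase s d) ^ 2 := by gcongr; lia
      _ = 4 * layerBase s d ^ 2 := by ring
  calc subEdge s d ^ 3 = subEdge s d ^ 2 * subEdge s d := pow_succ _ 2
    _ ≤ subEdge s d ^ 2 * (4 * layerBase s d ^ 2) := Nat.mul_le_mul_left _ hsq
    _ = 4 * chunk s d ^ 2 := by rw [chunk]; ring

variable {α : ℝ}

lemma two_pow_depth_le_rpow (h2 : 2 ≤ α) (hn : 1 ≤ n) :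
    (2 : ℝ) ^ depth α n ≤ (n : ℝ) ^ (α - 2) := by
  have hexp : 0 ≤ (α - 2) * Real.logb 2 n :=
    mul_nonneg (by linarith) (Real.logb_nonneg (by norm_num) (by exact_mod_cast hn))
  calc (2 : ℝ) ^ depth α n = (2 : ℝ) ^ (depth α n : ℝ) := (Real.rpow_natCast _ _).symm
    _ ≤ (2 : ℝ) ^ ((α - 2) * Real.logb 2 n) :=
      Real.rpow_le_rpow_of_exponent_le (by norm_num) (Nat.floor_le hexp)
    _ = (n : ℝ) ^ (α - 2) := by
      rw [mul_comm, Real.rpow_mul (by norm_num),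
        Real.rpow_logb (by norm_num) (by norm_num) (by exact_mod_cast hn)]

lemma rpow_le_two_mul_two_pow_depth (hn : 1 ≤ n) :
    (n : ℝ) ^ (α - 2) ≤ 2 * 2 ^ depth α n := by
  calc (n : ℝ) ^ (α - 2) = (2 : ℝ) ^ ((α - 2) * Real.logb 2 n) := by
        rw [mul_comm, Real.rpow_mul (by norm_num),
          Real.rpow_logb (by norm_num) (by norm_num) (by exact_mod_cast hn)]
    _ ≤ (2 : ℝ) ^ ((depth α n : ℝ) + 1) :=
      Real.rpow_le_rpow_of_exponent_le (by norm_num) (Nat.lt_floor_add_one _).le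
    _ = 2 * 2 ^ depth α n := by
      rw [Real.rpow_add (by norm_num), Real.rpow_natCast, Real.rpow_one, mul_comm]

lemma edge_le_two_mul_rpow (h0 : 0 ≤ α) (hn : 1 ≤ n) :
    (edge α n : ℝ) ≤ 2 * (n : ℝ) ^ (α / 3) := by
  have hceil : (edge α n : ℝ) < (n : ℝ) ^ (α / 3) + 1 := Nat.ceil_lt_add_one (by positivity)
  have hone : 1 ≤ (n : ℝ) ^ (α / 3) := Real.one_le_rpow (by exact_mod_cast hn) (by linarith)
  linarith

lemma two_pow_depth_le_self (h2 : 2 ≤ α) (h3 : α ≤ 3) (hn : 1 ≤ n) : 2 ^ depth α n ≤ n := by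
  have hreal : (2 : ℝ) ^ depth α n ≤ (n : ℝ) ^ (1 : ℝ) := (two_pow_depth_le_rpow h2 hn).trans
    (Real.rpow_le_rpow_of_exponent_le (by exact_mod_cast hn) (by linarith))
  rw [Real.rpow_one] at hreal
  exact_mod_cast hreal

lemma two_pow_depth_le_edge (h2 : 2 ≤ α) (h3 : α ≤ 3) (hn : 1 ≤ n) :
    2 ^ depth α n ≤ edge α n := by
  have hreal : (2 : ℝ) ^ depth α n ≤ edge α n := calc
    (2 : ℝ) ^ depth α n ≤ (n : ℝ) ^ (α - 2) := two_pow_depth_le_rpow h2 hn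
    _ ≤ (n : ℝ) ^ (α / 3) :=
      Real.rpow_le_rpow_of_exponent_le (by exact_mod_cast hn) (by linarith)
    _ ≤ edge α n := Nat.le_ceil _
  exact_mod_cast hreal

lemma rpow_div_three_eq (hn : 1 ≤ n) :
    (n : ℝ) ^ (α / 3) = (n : ℝ) ^ (2 * (3 - α) / 3) * (n : ℝ) ^ (α - 2) := by
  rw [← Real.rpow_add (by exact_mod_cast hn)]
  ring_nf

lemma rpow_pow_three_eq (n : ℕ) (β : ℝ) : ((n : ℝ) ^ (2 * β / 3)) ^ 3 = ((n : ℝ) ^ β) ^ 2 := by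
  rw [← Real.rpow_natCast, ← Real.rpow_natCast, ← Real.rpow_mul (by positivity),
    ← Real.rpow_mul (by positivity)]
  push_cast
  ring_nf

lemma rpow_le_two_mul_subEdge (h2 : 2 ≤ α) (h3 : α ≤ 3) (hn : 1 ≤ n) :
    (n : ℝ) ^ (2 * (3 - α) / 3) ≤ 2 * subEdge (edge α n) (depth α n) := by
  have hpos : (1 : ℝ) ≤ subEdge (edge α n) (depth α n) := by
    exact_mod_cast subEdge_pos (two_pow_depth_le_edge h2 h3 hn)
  have hdiv : (edge α n : ℝ) ≤ 2 ^ depth α n * (subEdge (edge α n) (depth α n) + 1) := by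
    exact_mod_cast (Nat.lt_mul_div_succ (edge α n) (by positivity)).le
  suffices h : (n : ℝ) ^ (2 * (3 - α) / 3) ≤ subEdge (edge α n) (depth α n) + 1 by linarith
  refine le_of_mul_le_mul_left (a := (2 : ℝ) ^ depth α n) ?_ (by positivity)
  calc (2 : ℝ) ^ depth α n * (n : ℝ) ^ (2 * (3 - α) / 3)
      ≤ (n : ℝ) ^ (α - 2) * (n : ℝ) ^ (2 * (3 - α) / 3) := by
        gcongr; exact two_pow_depth_le_rpow h2 hn
    _ = (n : ℝ) ^ (α / 3) := by rw [rpow_div_three_eq (α := α) hn, mul_comm]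
    _ ≤ edge α n := Nat.le_ceil _
    _ ≤ _ := hdiv

lemma subEdge_le_four_mul_rpow (h0 : 0 ≤ α) (hn : 1 ≤ n) :
    (subEdge (edge α n) (depth α n) : ℝ) ≤ 4 * (n : ℝ) ^ (2 * (3 - α) / 3) := by
  have hdiv : (2 : ℝ) ^ depth α n * subEdge (edge α n) (depth α n) ≤ edge α n := by
    exact_mod_cast Nat.mul_div_le (edge α n) (2 ^ depth α n)
  refine le_of_mul_le_mul_left (a := (2 : ℝ) ^ depth α n) ?_ (by positivity)
  calc _ ≤ (edge α n : ℝ) := hdiv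
    _ ≤ 2 * (n : ℝ) ^ (α / 3) := edge_le_two_mul_rpow h0 hn
    _ = 2 * ((n : ℝ) ^ (2 * (3 - α) / 3) * (n : ℝ) ^ (α - 2)) := by rw [rpow_div_three_eq hn]
    _ ≤ 2 * ((n : ℝ) ^ (2 * (3 - α) / 3) * (2 * 2 ^ depth α n)) := by
      gcongr; exact rpow_le_two_mul_two_pow_depth hn
    _ = _ := by ring

lemma rpow_le_six_mul_chunk (h2 : 2 ≤ α) (h3 : α ≤ 3) (hn : 1 ≤ n) :
    (n : ℝ) ^ (3 - α) ≤ 6 * chunk (edge α n) (depth α n) := by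
  have hcube : (subEdge (edge α n) (depth α n) : ℝ) ^ 3 ≤
      4 * (chunk (edge α n) (depth α n) : ℝ) ^ 2 := by
    exact_mod_cast subEdge_pow_three_le (two_pow_depth_le_edge h2 h3 hn)
  refine le_of_sq_le_sq ?_ (by positivity)
  calc ((n : ℝ) ^ (3 - α)) ^ 2 = ((n : ℝ) ^ (2 * (3 - α) / 3)) ^ 3 := (rpow_pow_three_eq n _).symm
    _ ≤ (2 * subEdge (edge α n) (depth α n)) ^ 3 := by
      gcongr; exact rpow_le_two_mul_subEdge h2 h3 hn
    _ ≤ (6 * chunk (edge α n) (depth α n)) ^ 2 := by nlinarith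

lemma chunk_le_eight_mul_rpow (h0 : 0 ≤ α) (hn : 1 ≤ n) :
    (chunk (edge α n) (depth α n) : ℝ) ≤ 8 * (n : ℝ) ^ (3 - α) := by
  refine le_of_sq_le_sq ?_ (by positivity)
  calc (chunk (edge α n) (depth α n) : ℝ) ^ 2 ≤ (subEdge (edge α n) (depth α n) : ℝ) ^ 3 := by
        exact_mod_cast chunk_sq_le (edge α n) (depth α n)
    _ ≤ (4 * (n : ℝ) ^ (2 * (3 - α) / 3)) ^ 3 := by
      gcongr; exact subEdge_le_four_mul_rpow h0 hn
    _ = (8 * (n : ℝ) ^ (3 - α)) ^ 2 := by rw [mul_pow, rpow_pow_three_eq]; ring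

lemma div_two_pow_depth_add_one_le (h2 : 2 ≤ α) (h3 : α ≤ 3) (hn : 1 ≤ n) :
    n / 2 ^ depth α n + 1 ≤ 13 * chunk (edge α n) (depth α n) := by
  have hpos := chunk_pos (two_pow_depth_le_edge h2 h3 hn)
  suffices h : ((n / 2 ^ depth α n : ℕ) : ℝ) ≤ 12 * chunk (edge α n) (depth α n) by
    have h' : n / 2 ^ depth α n ≤ 12 * chunk (edge α n) (depth α n) := by exact_mod_cast h
    lia
  calc ((n / 2 ^ depth α n : ℕ) : ℝ) ≤ n / 2 ^ depth α n := by exact_mod_cast Nat.cast_div_le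
    _ = (n : ℝ) ^ (3 - α) * (n : ℝ) ^ (α - 2) / 2 ^ depth α n := by
      rw [← Real.rpow_add (by exact_mod_cast hn)]; norm_num
    _ ≤ (n : ℝ) ^ (3 - α) * (2 * 2 ^ depth α n) / 2 ^ depth α n := by
      gcongr; exact rpow_le_two_mul_two_pow_depth hn
    _ = 2 * (n : ℝ) ^ (3 - α) := by field_simp
    _ ≤ 12 * chunk (edge α n) (depth α n) := by linarith [rpow_le_six_mul_chunk h2 h3 hn]

end Sizes

/-! ### The running time of Algorithm A -/

section RunningTime

variable {s n d : ℕ}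

/-- The number of steps taken by Algorithm A, in units of `s + chunk s d`, if the blocks of the last
level are cut into `N` chunks in each direction. -/
def timeFactor (N : ℕ) : ℕ := N * N * (48 * N + 27)

lemma cost_le_timeFactor_mul (hs : 2 ^ d ≤ s) (N : ℕ) :
    N * N * (N * (24 * s + 24 + layerBase s d * (10 * subEdge s d + 4)) + (2 * s + 5 * d) +
      (10 * s + 10)) ≤ timeFactor N * (s + chunk s d) := by
  have hd : d ≤ s := Nat.lt_two_pow_self.le.trans hs
  have hone : 1 ≤ s := Nat.one_le_two_pow.trans hs
  have hlayer : layerBase s d * (10 * subEdge s d + 4) ≤ 14 * chunk s d := by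
    have := subEdge_pos hs
    rw [chunk]
    nlinarith
  rw [timeFactor, mul_assoc (N * N)]
  refine Nat.mul_le_mul_left _ ?_
  calc _ ≤ N * (48 * (s + chunk s d)) + (2 * s + 5 * d) + (10 * s + 10) := by gcongr; lia
    _ ≤ N * (48 * (s + chunk s d)) + 27 * (s + chunk s d) := by lia
    _ = (48 * N + 27) * (s + chunk s d) := by ring

lemma card_ctrl_le {C T : ℕ} (hT : T ≤ C * s ^ 3) :
    s ^ 3 * (T + 1) ≤ (s ^ 3 + 2) ^ (C + 3) := by
  have hC : C + 1 ≤ (s ^ 3 + 2) ^ (C + 1) :=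
    Nat.lt_two_pow_self.le.trans (Nat.pow_le_pow_left (by lia) _)
  calc s ^ 3 * (T + 1) ≤ (s ^ 3 + 2) * ((C + 1) * (s ^ 3 + 2)) := by
        gcongr ?_ * ?_
        · lia
        · linarith [Nat.zero_le (s ^ 3), Nat.zero_le C]
    _ ≤ (s ^ 3 + 2) * ((s ^ 3 + 2) ^ (C + 1) * (s ^ 3 + 2)) := by gcongr
    _ = (s ^ 3 + 2) ^ (C + 3) := by ring

lemma inputKept_initialRegs (LA LB : Layout n s) :
    InputKept LA LB (initialRegs 0 1 LA LB (Matrix.of Term.entryA) (Matrix.of Term.entryB)) where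
  entryA i k := by simp [initialRegs, stored, Function.partialInv_left LA.injective]
  entryB k j := by simp [initialRegs, stored, Function.partialInv_left LB.injective]

lemma exists_program_followsAlgorithmA {N : ℕ} (hn : 2 ^ d ≤ n) (hs : 2 ^ d ≤ s)
    (hN : n / 2 ^ d + 1 ≤ N * chunk s d) (LA LB LC : Layout n s) :
    ∃ P : Program s 14 (timeFactor N * 2 + 3), P.FollowsAlgorithmA LA LB d ∧
      IsLeast {T : ℕ | Program.ComputesWithin.{u} P LA LB LC T}
        (timeFactor N * (s + chunk s d)) := by
  have hpos : 0 < s := Nat.one_le_two_pow.trans hs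
  have hT : timeFactor N * (s + chunk s d) ≤ timeFactor N * 2 * s ^ 3 := by
    rw [mul_assoc]
    refine Nat.mul_le_mul_left _ ?_
    have hedge : s ≤ s ^ 3 := Nat.le_self_pow (by norm_num) s
    have hchunk : chunk s d ≤ s ^ 3 :=
      (chunk_le_sq s d).trans (Nat.pow_le_pow_right hpos (by norm_num))
    lia
  exact exists_program_of_reach hpos (card_ctrl_le hT) (by decide)
    ((reach_product hn hs hN LC (inputKept_initialRegs LA LB)).weaken
      (cost_le_timeFactor_mul hs N) fun _ h => h)

variable {α : ℝ}

lemma timeFactor_mul_le (h0 : 0 ≤ α) (h9 : α ≤ 9 / 4) (hn : 1 ≤ n) (N : ℕ) :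
    ((timeFactor N * (edge α n + chunk (edge α n) (depth α n)) : ℕ) : ℝ) ≤
      10 * timeFactor N * (n : ℝ) ^ (3 - α) := by
  have hedge : (n : ℝ) ^ (α / 3) ≤ (n : ℝ) ^ (3 - α) :=
    Real.rpow_le_rpow_of_exponent_le (by exact_mod_cast hn) (by linarith)
  have hsum : (edge α n : ℝ) + chunk (edge α n) (depth α n) ≤ 10 * (n : ℝ) ^ (3 - α) := by
    linarith [edge_le_two_mul_rpow h0 hn, chunk_le_eight_mul_rpow h0 hn]
  push_cast
  calc _ ≤ (timeFactor N : ℝ) * (10 * (n : ℝ) ^ (3 - α)) := by gcongr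
    _ = _ := by ring

lemma rpow_le_of_computesWithin_edge {R w T : ℕ} (h0 : 0 ≤ α) (hn : 1 ≤ n)
    {P : Program (edge α n) R w} {LA LB LC : Layout n (edge α n)}
    (h : Program.ComputesWithin.{u} P LA LB LC T) : 1 / 8 * (n : ℝ) ^ (3 - α) ≤ T := by
  have hn0 : (0 : ℝ) < n := by exact_mod_cast hn
  suffices hmul : (n : ℝ) ^ (3 - α) * (n : ℝ) ^ α ≤ 8 * T * (n : ℝ) ^ α by
    linarith [le_of_mul_le_mul_right hmul (by positivity)]
  calc (n : ℝ) ^ (3 - α) * (n : ℝ) ^ α = (n : ℝ) ^ 3 := by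
        rw [← Real.rpow_add hn0, sub_add_cancel]; norm_cast
    _ ≤ (edge α n : ℝ) ^ 3 * T := by
      exact_mod_cast pow_three_le_pow_three_mul_of_computesWithin h
    _ ≤ (2 * (n : ℝ) ^ (α / 3)) ^ 3 * T := by gcongr; exact edge_le_two_mul_rpow h0 hn
    _ = 8 * T * (n : ℝ) ^ α := by
      rw [mul_pow, ← Real.rpow_natCast (_ ^ _), ← Real.rpow_mul hn0.le]
      push_cast
      ring_nf

end RunningTime

end Mesh

open Mesh in
theorem theorem1_general :
    (∃ (R w : ℕ) (c C : ℝ), 0 < c ∧ 0 < C ∧ ∀ α : ℝ, 2 ≤ α → α ≤ 9 / 4 → ∀ n : ℕ, 1 ≤ n →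
      ∀ LA LB LC : Layout n (edge α n), ∃ (P : Program (edge α n) R w) (T : ℕ),
        P.FollowsAlgorithmA LA LB (depth α n) ∧
        IsLeast {T' : ℕ | Program.ComputesWithin.{u} P LA LB LC T'} T ∧
        c * (n : ℝ) ^ (3 - α) ≤ T ∧ (T : ℝ) ≤ C * (n : ℝ) ^ (3 - α)) ∧
    ∃ c : ℝ, 0 < c ∧ ∀ (R w n s : ℕ) (P : Program s R w) (LA LB LC : Layout n s) (T : ℕ),
      Program.ComputesWithin.{u} P LA LB LC T → c * (n : ℝ) ^ (3 / 4 : ℝ) ≤ T := by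
  refine ⟨⟨14, timeFactor 13 * 2 + 3, 1 / 8, 10 * timeFactor 13, by norm_num,
    by norm_num [timeFactor], fun α h2 h9 n hn LA LB LC => ?_⟩,
    1 / 11, by norm_num, fun _ _ _ _ _ _ _ _ _ h => rpow_le_of_computesWithin h⟩
  have h0 : 0 ≤ α := by linarith
  have h3 : α ≤ 3 := by linarith
  obtain ⟨P, hP, hT⟩ := exists_program_followsAlgorithmA (two_pow_depth_le_self h2 h3 hn)
    (two_pow_depth_le_edge h2 h3 hn) (div_two_pow_depth_add_one_le h2 h3 hn) LA LB LC
  exact ⟨P, _, hP, hT, rpow_le_of_computesWithin_edge h0 hn hT.1, timeFactor_mul_le h0 h9 hn 13⟩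

theorem theorem1 :
    (∃ R w : ℕ,
      (∀ α : ℝ, 2 ≤ α → α ≤ 9 / 4 → Mesh.AlgorithmATakesTheta.{u} R w α (3 - α)) ∧
      Mesh.AlgorithmATakesTheta.{u} R w (9 / 4) (3 / 4)) ∧
    ∃ c : ℝ, 0 < c ∧ ∀ (R w n s : ℕ) (P : Mesh.Program s R w) (LA LB LC : Mesh.Layout n s) (T : ℕ),
      Mesh.Program.ComputesWithin.{u} P LA LB LC T → c * (n : ℝ) ^ (3 / 4 : ℝ) ≤ T := by
  refine theorem1_general.imp_left fun ⟨R, w, c, C, hc, hC, h⟩ => ?_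
  have hθ (α : ℝ) (h2 : 2 ≤ α) (h9 : α ≤ 9 / 4) : Mesh.AlgorithmATakesTheta.{u} R w α (3 - α) :=
    ⟨c, C, hc, hC, fun n hn LA LB LC _ _ _ => h α h2 h9 n hn LA LB LC⟩
  exact ⟨R, w, hθ, by convert hθ (9 / 4) (by norm_num) le_rfl using 1; norm_num⟩
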